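/- Let $\mathcal X \neq \{0\}$ be a complex Banach space with dual $\mathcal X'$, and let $\mathcal T:\mathbb R\to B(\mathcal X)$ be a strongly continuous representation of the additive group $\mathbb R$ by linear isometries. For $f\in L^1(\mathbb R)$ and $v\in\mathcal X$ put $fv=\int_{\mathbb R} f(t)\,\mathcal T(-t)v\,dt$ and $\widehat f(\xi)=\int_{\mathbb R} f(t)e^{-it\xi}\,dt$, and let the Beurling spectrum of $\mathcal T$ be $$\Lambda(\mathcal X,\mathcal T)=\{\xi\in\mathbb R:\ \text{if } f\in L^1(\mathbb R) \text{ and } fv=0 \text{ for all } v\in\mathcal X, \text{ then } \widehat f(\xi)=0\}.$$ For $1\le p<\infty$, sequences $Y=\{y_n\}_{n\in\mathbb Z}\subset\mathcal X'$ and $X=\{x_n\}_{n\in\mathbb Z}\subset\mathcal X$ are said to form an atomic decomposition $(Y,X)$ of $\mathcal X$ with respect to $\ell^p(\mathbb Z)$ with bounds $A$ and $B$ if for every $v\in\mathcal X$ one has $\{\langle v,y_n\rangle\}_n\in\ell^p(\mathbb Z)$, $A\|v\|\le\|\{\langle v,y_n\rangle\}_n\|_p\le B\|v\|$, and $v=\sum_{n\in\mathbb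 Z}\langle v,y_n\rangle x_n$. Series over $\mathbb Z$ are limits of $\sum_{n=-M}^{N}$ as $M,N\to\infty$ independently. A basis is a Schauder basis indexed by $\mathbb Z$: a sequence $\{x_n\}_{n\in\mathbb Z}$ that has a biorthogonal sequence $\{f_n\}_{n\in\mathbb Z}\subset\mathcal X'$ such that $v=\sum_{n\in\mathbb Z}f_n(v)x_n$ for every $v\in\mathcal X$. **Theorem.** Suppose that $\Lambda(\mathcal X,\mathcal T)\subseteq[-\gamma,\gamma]$ for some $\gamma>0$. Let $x\in\mathcal X$, let $\{\gamma_n\}_{n\in\mathbb Z}$ be a sequence of real numbers, and put $X=\{\mathcal T(\gamma_n)x\}_{n\in\mathbb Z}$. Assume that $Y=\{y_n\}_{n\in\mathbb Z}\subset\mathcal X'$ is such that $(Y,X)$ is an atomic decomposition of $\mathcal X$ with respect to $\ell^p(\mathbb Z)$, for some $p\in[1,\infty)$, with bounds $B\ge A>0$, and that the synthesis operator $T_X:\ell^p(\mathbb Z)\to\mathcal X$, $T_Xc=\sum_{n\in\mathbb Z}c_n\mathcal T(\gamma_n)x$, is defined on all of $\ell^p(\mathbb Z)$ and bounded. Let $\{\widetilde\gamma_n\}_{n\in\mathbb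 Z}$ be a sequence of real numbers such that $$\delta:=\sup_{n\in\mathbb Z}|\widetilde\gamma_n-\gamma_n|<\frac{\pi}{4\gamma}-\frac1\gamma\arcsin\left(\frac1{\sqrt2}\left(1-\frac1{B\|T_X\|}\right)\right).$$ Then there is a sequence $Z\subset\mathcal X'$ such that $(Z,W)$, where $W=\{\mathcal T(\widetilde\gamma_n)x\}_{n\in\mathbb Z}$, is an atomic decomposition of $\mathcal X$ with respect to $\ell^p(\mathbb Z)$ with bounds $$A\bigl(1+B\|T_X\|(1-\cos\delta\gamma+\sin\delta\gamma)\bigr)^{-1}\quad\text{and}\quad B\bigl(1-B\|T_X\|(1-\cos\delta\gamma+\sin\delta\gamma)\bigr)^{-1}.$$ Moreover, if $X$ is a basis of $\mathcal X$, then so is $W$. -/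

import Mathlib

open MeasureTheory
open scoped ENNReal

/-- A strongly continuous isometric representation of the group `ℝ` on a complex normed space:
`T 0 = I`, `T (s + t) = T s T t`, every `T t` is isometric, and every orbit is continuous. -/
structure IsIsometricRep {E : Type*} [NormedAddCommGroup E] [NormedSpace ℂ E]
    (T : ℝ → E →L[ℂ] E) : Prop where
  map_zero : T 0 = ContinuousLinearMap.id ℂ E
  map_add : ∀ s t : ℝ, T (s + t) = (T s).comp (T t)
  norm_map : ∀ (t : ℝ) (v : E), ‖T t v‖ = ‖v‖
  continuous_orbit : ∀ v : E, Continuous fun t : ℝ => T t v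

/-- The `L¹(ℝ)`-module action associated with a representation: `f v = ∫ f(t) T(-t) v dt`. -/
noncomputable def moduleAction {E : Type*} [NormedAddCommGroup E] [NormedSpace ℂ E]
    (T : ℝ → E →L[ℂ] E) (f : ℝ → ℂ) (v : E) : E :=
  ∫ t : ℝ, f t • T (-t) v

/-- The Fourier transform in the normalization `∫ f(t) e^{-itξ} dt`. -/
noncomputable def fourierHat (f : ℝ → ℂ) (ξ : ℝ) : ℂ :=
  ∫ t : ℝ, f t * Complex.exp (-(Complex.I * t * ξ))

/-- The Beurling spectrum `Λ(N, T)` of a subset `N`: all real `ξ` such that the Fourier transform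
of every integrable function annihilating `N` vanishes at `ξ`. -/
def beurlingSpectrum {E : Type*} [NormedAddCommGroup E] [NormedSpace ℂ E]
    (T : ℝ → E →L[ℂ] E) (N : Set E) : Set ℝ :=
  {ξ : ℝ | ∀ f : ℝ → ℂ, Integrable f → (∀ v ∈ N, moduleAction T f v = 0) → fourierHat f ξ = 0}

/-- `(y, x)` is an atomic decomposition of `E` with respect to `ℓ^p(ℤ)` with bounds `A` and `B`.
The series over `ℤ` is the two-sided one: the limit of the sums over `-M ≤ n ≤ N` as `M` and `N`
tend to infinity independently. -/
structure IsAtomicDecomposition {E : Type*} [NormedAddCommGroup E] [NormedSpace ℂ E]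
    (p : ℝ≥0∞) (A B : ℝ) (y : ℤ → StrongDual ℂ E) (x : ℤ → E) : Prop where
  memlp : ∀ v : E, Memℓp (fun n : ℤ => y n v) p
  lower_bound : ∀ v : E, A * ‖v‖ ≤ ‖(⟨fun n : ℤ => y n v, memlp v⟩ : lp (fun _ : ℤ => ℂ) p)‖
  upper_bound : ∀ v : E, ‖(⟨fun n : ℤ => y n v, memlp v⟩ : lp (fun _ : ℤ => ℂ) p)‖ ≤ B * ‖v‖
  expansion : ∀ v : E, HasSum (fun n : ℤ => y n v • x n) v (SummationFilter.conditional ℤ)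

/-- `S` is the synthesis operator of `x`, defined on all of `ℓ^p(ℤ)` and bounded there:
`S c = ∑ c_n x_n` (two-sided series) for every `c`. -/
def IsSynthesisOperator {E : Type*} [NormedAddCommGroup E] [NormedSpace ℂ E]
    (p : ℝ≥0∞) [Fact (1 ≤ p)] (x : ℤ → E) (S : lp (fun _ : ℤ => ℂ) p →L[ℂ] E) : Prop :=
  ∀ c : lp (fun _ : ℤ => ℂ) p,
    HasSum (fun n : ℤ => c n • x n) (S c) (SummationFilter.conditional ℤ)

/-- `x` is a (two-sided) Schauder basis of `E`. -/
def IsTwoSidedBasis {E : Type*} [NormedAddCommGroup E] [NormedSpace ℂ E] (x : ℤ → E) : Prop :=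
  ∃ b : GeneralSchauderBasis ℤ ℂ E (SummationFilter.conditional ℤ), b.basis = x

/-! The argument carries Kadec's 1/4-theorem from exponentials to orbits of `T`. On `[-π, π]`, `exp
(iτθ) = cos τθ + i sin τθ`. The cosine is expanded in the frequencies `n` and the sine in the
frequencies `n - 1/2`; both series converge absolutely for `|τ| ≤ 1/4`. For `|τ| ≤ τ₀ ≤ 1/4`, the
deviations of the coefficients from those of the constant `1` are dominated by a sequence with sum
`1 - cos πτ₀ + sin πτ₀` (`exists_expansion_exp`).

Since the spectrum is bounded, `T s` acts as the Fourier multiplier `exp (isξ)` cut off near the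
spectrum, so an absolutely convergent expansion of this exponential on a slightly larger interval
yields the same expansion of `T s` (`hasSum_smul_of_hasSum_exp`). This rests on two facts:
multipliers supported off the spectrum act as zero, and a cutoff equal to `1` near the spectrum acts
as the identity (`multiplier_eq_self`).

Applied to `T (g' n - g n)`, the expansion writes the difference of the two synthesis operators as a
sum of terms `T (μ j) ∘ S ∘ (multiplication by a bounded sequence)`. Its norm is at most `‖S‖ (1 -
cos δγ + sin δγ)`. The arcsine hypothesis says precisely that this bound times `B` is below `1`, so
new synthesis after old analysis is invertible by a Neumann series, and its inverse transports the
decomposition (`perturb`). -/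

open Filter Topology
open scoped SchwartzMap FourierTransform Convolution

/-! ### The convolution algebra acting on `E`, and Fourier multipliers. -/

namespace IsIsometricRep

variable {E : Type*} [NormedAddCommGroup E] [NormedSpace ℂ E] {T : ℝ → E →L[ℂ] E}

theorem integrable_smul_orbit (hT : IsIsometricRep T) {f : ℝ → ℂ} (hf : Integrable f) (v : E) :
    Integrable fun t => f t • T (-t) v := by
  have hc : Continuous fun t : ℝ => T (-t) v := (hT.continuous_orbit v).comp continuous_neg
  refine hf.norm.smul_const ‖v‖ |>.mono' (hf.aestronglyMeasurable.smul hc.aestronglyMeasurable) ?_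
  filter_upwards with t
  simp [norm_smul, hT.norm_map]

theorem map_moduleAction [CompleteSpace E] (hT : IsIsometricRep T) {f : ℝ → ℂ}
    (hf : Integrable f) (s : ℝ) (v : E) :
    T s (moduleAction T f v) = ∫ t, f t • T (s - t) v := by
  rw [moduleAction, ← (T s).integral_comp_comm (hT.integrable_smul_orbit hf v)]
  simp [sub_eq_add_neg, hT.map_add]

theorem map_moduleAction' [CompleteSpace E] (hT : IsIsometricRep T) {f : ℝ → ℂ}
    (hf : Integrable f) (s : ℝ) (v : E) :
    T s (moduleAction T f v) = ∫ t, f (s + t) • T (-t) v := by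
  rw [hT.map_moduleAction hf, ← integral_add_left_eq_self _ s]
  simp

theorem moduleAction_convolution [CompleteSpace E] (hT : IsIsometricRep T) {f g : ℝ → ℂ}
    (hf : Integrable f) (hg : Integrable g) (v : E) :
    moduleAction T (f ⋆[ContinuousLinearMap.mul ℂ ℂ] g) v =
      moduleAction T f (moduleAction T g v) := by
  have hc : Continuous fun q : ℝ × ℝ => T (-q.1) v :=
    (hT.continuous_orbit v).comp (continuous_neg.comp continuous_fst)
  have hi := hf.convolution_integrand (ContinuousLinearMap.mul ℂ ℂ) hg
  have hi' : Integrable (fun q : ℝ × ℝ => (f q.2 * g (q.1 - q.2)) • T (-q.1) v)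
      (volume.prod volume) := by
    refine hi.norm.smul_const ‖v‖ |>.mono' (hi.aestronglyMeasurable.smul hc.aestronglyMeasurable) ?_
    filter_upwards with t
    simp [norm_smul, hT.norm_map]
  calc moduleAction T (f ⋆[ContinuousLinearMap.mul ℂ ℂ] g) v
      = ∫ x, ∫ y, (f y * g (x - y)) • T (-x) v := by
        simp only [moduleAction, convolution, ContinuousLinearMap.mul_apply', ← integral_smul_const]
    _ = ∫ y, ∫ x, (f y * g (x - y)) • T (-x) v := integral_integral_swap hi'
    _ = moduleAction T f (moduleAction T g v) := by
        refine integral_congr_ae (.of_forall fun y => ?_)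
        simp only
        rw [hT.map_moduleAction' hg, ← integral_smul]
        refine integral_congr_ae (.of_forall fun x => ?_)
        simp [mul_smul, sub_eq_neg_add]

/-- The action of the inverse Fourier transform of a Schwartz function on a fixed vector. -/
noncomputable def multiplier (hT : IsIsometricRep T) (v : E) : 𝓢(ℝ, ℂ) →ₗ[ℂ] E where
  toFun ψ := moduleAction T (𝓕⁻ ψ : 𝓢(ℝ, ℂ)) v
  map_add' φ ψ := by
    simp only [moduleAction, FourierTransform.fourierInv_add, add_apply, add_smul]
    exact integral_add (hT.integrable_smul_orbit (SchwartzMap.integrable _) v)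
      (hT.integrable_smul_orbit (SchwartzMap.integrable _) v)
  map_smul' c ψ := by
    simp only [moduleAction, FourierTransform.fourierInv_smul, smul_apply, smul_assoc]
    exact integral_smul _ _

theorem multiplier_apply (hT : IsIsometricRep T) (v : E) (ψ : 𝓢(ℝ, ℂ)) :
    hT.multiplier v ψ = moduleAction T (𝓕⁻ ψ : 𝓢(ℝ, ℂ)) v := rfl

/-- The inverse Fourier transform turns products into convolutions, and convolution acts by
composition; hence symbols multiply as operators compose. -/
theorem multiplier_pairing [CompleteSpace E] (hT : IsIsometricRep T) (v : E) (φ ψ : 𝓢(ℝ, ℂ)) :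
    hT.multiplier v (SchwartzMap.pairing (ContinuousLinearMap.mul ℂ ℂ) φ ψ) =
      hT.multiplier (hT.multiplier v ψ) φ := by
  simp only [multiplier_apply]
  rw [← hT.moduleAction_convolution (SchwartzMap.integrable _) (SchwartzMap.integrable _)]
  congr 1
  have h := SchwartzMap.convolution_apply (ContinuousLinearMap.mul ℂ ℂ) (𝓕⁻ φ) (𝓕⁻ ψ)
  ext t
  rw [← h]
  simp [SchwartzMap.convolution]

end IsIsometricRep

theorem fourierHat_eq_fourier (f : ℝ → ℂ) (ξ : ℝ) :
    fourierHat f ξ = 𝓕 f (ξ / (2 * Real.pi)) := by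
  rw [fourierHat, Real.fourier_eq']
  refine integral_congr_ae (.of_forall fun t => ?_)
  simp only [smul_eq_mul, mul_comm (f t)]
  congr 2
  have : (Real.pi : ℂ) ≠ 0 := by exact_mod_cast Real.pi_ne_zero
  simp
  field_simp

/-! ### L¹ continuity of translation and rescaled symbols. -/

namespace SchwartzMap

theorem exists_norm_le_inv_one_add_sq (K : 𝓢(ℝ, ℂ)) :
    ∃ C, 0 ≤ C ∧ ∀ t, ‖K t‖ ≤ C * (1 + t ^ 2)⁻¹ := by
  obtain ⟨C₀, hC₀, h₀⟩ := K.decay 0 0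
  obtain ⟨C₂, hC₂, h₂⟩ := K.decay 2 0
  refine ⟨C₀ + C₂, by positivity, fun t => ?_⟩
  have h₀ := h₀ t
  have h₂ := h₂ t
  simp only [pow_zero, one_mul, norm_iteratedFDeriv_zero, Real.norm_eq_abs, sq_abs] at h₀ h₂
  rw [← div_eq_mul_inv, le_div_iff₀ (by positivity)]
  linarith

theorem tendsto_integral_norm_sub_translate (K : 𝓢(ℝ, ℂ)) :
    Tendsto (fun a : ℝ => ∫ t, ‖K t - K (t - a)‖) (𝓝 0) (𝓝 0) := by
  obtain ⟨C, hC, hK⟩ := K.exists_norm_le_inv_one_add_sq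
  have h0 : (0 : ℝ) = ∫ t : ℝ, (0 : ℝ) := by simp
  conv => arg 3; rw [h0]
  refine tendsto_integral_filter_of_dominated_convergence (fun t => 4 * C * (1 + t ^ 2)⁻¹)
    ?_ ?_ (integrable_inv_one_add_sq.const_mul _) ?_
  · filter_upwards with a
    have := K.continuous
    exact Continuous.aestronglyMeasurable (by fun_prop)
  · filter_upwards [Metric.ball_mem_nhds (0 : ℝ) one_pos] with a ha
    filter_upwards with t
    have ha : |a| < 1 := by simpa using ha
    have ha2 : a ^ 2 ≤ 1 := by nlinarith [abs_nonneg a, sq_abs a]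
    -- For `|a| < 1` a translate keeps the same decay up to the factor 3, which gives the majorant
    -- its constant `4 = 1 + 3`.
    have h1 : (1 + (t - a) ^ 2)⁻¹ ≤ 3 * (1 + t ^ 2)⁻¹ := by
      rw [← div_eq_mul_inv, inv_eq_one_div, div_le_div_iff₀ (by positivity) (by positivity)]
      nlinarith [sq_nonneg (t - 2 * a)]
    rw [norm_norm]
    calc ‖K t - K (t - a)‖ ≤ ‖K t‖ + ‖K (t - a)‖ := norm_sub_le _ _
      _ ≤ C * (1 + t ^ 2)⁻¹ + C * (1 + (t - a) ^ 2)⁻¹ := add_le_add (hK _) (hK _)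
      _ ≤ C * (1 + t ^ 2)⁻¹ + C * (3 * (1 + t ^ 2)⁻¹) := by gcongr
      _ = _ := by ring
  · filter_upwards with t
    have h : Continuous fun a : ℝ => ‖K t - K (t - a)‖ := by
      have := K.continuous
      fun_prop
    simpa using h.tendsto 0

theorem integral_norm_sub_translate_le (K : 𝓢(ℝ, ℂ)) (a : ℝ) :
    ∫ t, ‖K t - K (t - a)‖ ≤ 2 * ∫ t, ‖K t‖ := by
  have hi : Integrable K := K.integrable
  have hi' : Integrable fun t => K (t - a) := hi.comp_sub_right a
  calc ∫ t, ‖K t - K (t - a)‖ ≤ ∫ t, (‖K t‖ + ‖K (t - a)‖) :=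
        integral_mono (hi.sub hi').norm (hi.norm.add hi'.norm) fun t => norm_sub_le _ _
    _ = _ := by
        rw [integral_add hi.norm hi'.norm, integral_sub_right_eq_self (fun t => ‖K t‖) a]
        ring

theorem tendsto_integral_norm_mul_translate (K : 𝓢(ℝ, ℂ)) {f : ℝ → ℂ} (hf : Integrable f) :
    Tendsto (fun ε : ℝ => ∫ s, ‖f s‖ * ∫ t, ‖K t - K (t - ε * s)‖) (𝓝 0) (𝓝 0) := by
  have hK := K.continuous
  have hm : StronglyMeasurable fun a : ℝ => ∫ t, ‖K t - K (t - a)‖ :=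
    StronglyMeasurable.integral_prod_right (f := fun a t => ‖K t - K (t - a)‖)
      (Continuous.stronglyMeasurable (by fun_prop))
  have h0 : (0 : ℝ) = ∫ t : ℝ, (0 : ℝ) := by simp
  conv => arg 3; rw [h0]
  refine tendsto_integral_filter_of_dominated_convergence
    (fun s => ‖f s‖ * (2 * ∫ t, ‖K t‖)) ?_ ?_ (hf.norm.mul_const _) ?_
  · filter_upwards with ε
    exact hf.norm.aestronglyMeasurable.mul
      (hm.comp_measurable (by fun_prop)).aestronglyMeasurable
  · filter_upwards with ε
    filter_upwards with s
    rw [norm_mul, norm_norm, Real.norm_of_nonneg (integral_nonneg fun t => norm_nonneg _)]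
    exact mul_le_mul_of_nonneg_left (K.integral_norm_sub_translate_le _) (norm_nonneg _)
  · filter_upwards with s
    have h1 : Tendsto (fun ε : ℝ => ε * s) (𝓝 0) (𝓝 0) := by
      simpa using (continuous_mul_const s).tendsto 0
    simpa using (K.tendsto_integral_norm_sub_translate.comp h1).const_mul ‖f s‖

/-- The function `ω ↦ φ ((ω - ω₀) / ε)`. -/
noncomputable def rescale (φ : 𝓢(ℝ, ℂ)) (ω₀ : ℝ) (ε : ℝ) (hε : ε ≠ 0) : 𝓢(ℝ, ℂ) :=
  compSubConstCLM ℂ ω₀ (compCLMOfContinuousLinearEquiv ℂ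
    (ContinuousLinearEquiv.unitsEquivAut ℝ (Units.mk0 ε⁻¹ (inv_ne_zero hε))) φ)

theorem rescale_apply (φ : 𝓢(ℝ, ℂ)) (ω₀ : ℝ) {ε : ℝ} (hε : ε ≠ 0) (ω : ℝ) :
    φ.rescale ω₀ ε hε ω = φ ((ω - ω₀) / ε) := by
  simp [rescale, div_eq_mul_inv]

theorem fourierInv_rescale_apply (φ : 𝓢(ℝ, ℂ)) (ω₀ : ℝ) {ε : ℝ} (hε : 0 < ε) (t : ℝ) :
    (𝓕⁻ (φ.rescale ω₀ ε hε.ne') : 𝓢(ℝ, ℂ)) t =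
      ε * Complex.exp (2 * Real.pi * Complex.I * ω₀ * t) * (𝓕⁻ φ : 𝓢(ℝ, ℂ)) (ε * t) := by
  simp only [fourierInv_coe, Real.fourierInv_eq', rescale_apply]
  rw [← integral_add_right_eq_self _ ω₀]
  simp only [add_sub_cancel_right]
  have h := Measure.integral_comp_mul_left (fun w : ℝ =>
    Complex.exp (↑(2 * Real.pi * inner ℝ (w + ω₀) t) * Complex.I) • φ (w / ε)) ε
  rw [abs_of_pos (inv_pos.2 hε), eq_inv_smul_iff₀ hε.ne'] at h
  rw [← h, mul_assoc, ← integral_const_mul, Complex.real_smul]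
  congr 1
  refine integral_congr_ae (.of_forall fun w => ?_)
  simp only [mul_div_cancel_left₀ w hε.ne', smul_eq_mul, ← mul_assoc, ← Complex.exp_add]
  congr 2
  simp
  ring

end SchwartzMap

/-! ### Localization on the spectrum. -/

namespace IsIsometricRep

variable {E : Type*} [NormedAddCommGroup E] [NormedSpace ℂ E] {T : ℝ → E →L[ℂ] E}

theorem multiplier_rescale_apply (hT : IsIsometricRep T) (φ : 𝓢(ℝ, ℂ)) (ω₀ : ℝ) {ε : ℝ}
    (hε : 0 < ε) (v : E) :
    hT.multiplier v (φ.rescale ω₀ ε hε.ne') =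
      ∫ t : ℝ, (Complex.exp (2 * Real.pi * Complex.I * ω₀ * (ε⁻¹ * t)) * (𝓕⁻ φ : 𝓢(ℝ, ℂ)) t) •
        T (-(ε⁻¹ * t)) v := by
  rw [multiplier_apply, moduleAction]
  have h := Measure.integral_comp_mul_left (fun t : ℝ =>
    (Complex.exp (2 * Real.pi * Complex.I * ω₀ * (ε⁻¹ * t)) * (𝓕⁻ φ : 𝓢(ℝ, ℂ)) t) •
        T (-(ε⁻¹ * t)) v) ε
  rw [abs_of_pos (inv_pos.2 hε), eq_inv_smul_iff₀ hε.ne'] at h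
  rw [← h, ← integral_smul]
  refine integral_congr_ae (.of_forall fun t => ?_)
  have hε' : (ε : ℂ) ≠ 0 := by exact_mod_cast hε.ne'
  simp only [SchwartzMap.fourierInv_rescale_apply _ _ hε]
  rw [← Complex.coe_smul, smul_smul]
  push_cast
  rw [inv_mul_cancel_left₀ hε', inv_mul_cancel_left₀ hε.ne', mul_assoc]

/-- A symbol concentrated near `ω₀` makes `f` act almost as the scalar `𝓕 f ω₀`. The right side
tends to `0` with `ε`, uniformly on bounded sets of `v`. -/
theorem norm_smul_multiplier_rescale_sub_le [CompleteSpace E] (hT : IsIsometricRep T)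
    {f : ℝ → ℂ} (hf : Integrable f) (φ : 𝓢(ℝ, ℂ)) (ω₀ : ℝ) {ε : ℝ} (hε : 0 < ε) (v : E) :
    ‖𝓕 f ω₀ • hT.multiplier v (φ.rescale ω₀ ε hε.ne') -
        moduleAction T f (hT.multiplier v (φ.rescale ω₀ ε hε.ne'))‖ ≤
      (∫ s, ‖f s‖ * ∫ t, ‖(𝓕⁻ φ : 𝓢(ℝ, ℂ)) t - (𝓕⁻ φ : 𝓢(ℝ, ℂ)) (t - ε * s)‖) * ‖v‖ := by
  set K : 𝓢(ℝ, ℂ) := 𝓕⁻ φ with hK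
  set L : 𝓢(ℝ, ℂ) := 𝓕⁻ (φ.rescale ω₀ ε hε.ne') with hL
  have hLi : Integrable L := L.integrable
  set M := hT.multiplier v (φ.rescale ω₀ ε hε.ne') with hM
  have hM' : M = ∫ t, L t • T (-t) v := rfl
  -- The kernel is `L t = ε exp (2πiω₀t) K (εt)`: translating it by `s` gives the phase, up to a
  -- translation of `K` by only `ε s`.
  have hcomp : ∀ s : ℝ, ‖Complex.exp (-(2 * Real.pi * Complex.I * ω₀ * s)) • M - T (-s) M‖ ≤
      (∫ t, ‖K t - K (t - ε * s)‖) * ‖v‖ := by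
    intro s
    have h1 : T (-s) M = ∫ t, L (-s + t) • T (-t) v := hT.map_moduleAction' hLi (-s) v
    have hLs : Integrable fun t => L (-s + t) := hLi.comp_add_left (-s)
    rw [h1, hM', ← integral_smul]
    simp only [smul_smul]
    rw [← integral_sub (hT.integrable_smul_orbit (hLi.const_mul _) v)
      (hT.integrable_smul_orbit hLs v)]
    refine (norm_integral_le_integral_norm _).trans_eq ?_
    rw [← integral_mul_const]
    have h2 := Measure.integral_comp_mul_left (fun t : ℝ => ‖K t - K (t - ε * s)‖ * ‖v‖) ε
    rw [abs_of_pos (inv_pos.2 hε), eq_inv_smul_iff₀ hε.ne'] at h2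
    rw [← h2, ← integral_smul]
    refine integral_congr_ae (.of_forall fun t => ?_)
    simp only [← sub_smul, norm_smul, hT.norm_map, hL,
      SchwartzMap.fourierInv_rescale_apply _ _ hε, ← hK, smul_eq_mul, ← mul_assoc]
    congr 1
    have e1 : Complex.exp (2 * Real.pi * Complex.I * ω₀ * ((-s + t : ℝ) : ℂ)) =
        Complex.exp (-(2 * Real.pi * Complex.I * ω₀ * s)) *
          Complex.exp (2 * Real.pi * Complex.I * ω₀ * t) := by
      rw [← Complex.exp_add]
      congr 1
      push_cast
      ring
    have e2 : ε * (-s + t) = ε * t - ε * s := by ring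
    rw [e1, e2]
    have e3 : ∀ a b x y : ℂ, a * ε * b * x - ε * (a * b) * y = ε * (a * b) * (x - y) := by
      intros; ring
    rw [e3, norm_mul, norm_mul, ← Complex.exp_add, Complex.norm_exp]
    simp [abs_of_pos hε]
  have hi1 : Integrable fun s => f s • T (-s) M := hT.integrable_smul_orbit hf M
  have hi2 : Integrable fun s => f s * Complex.exp (-(2 * Real.pi * Complex.I * ω₀ * s)) := by
    refine hf.norm.mono' (hf.aestronglyMeasurable.mul
      (Continuous.aestronglyMeasurable (by fun_prop))) (.of_forall fun s => ?_)
    rw [norm_mul, Complex.norm_exp]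
    simp
  have hF : 𝓕 f ω₀ = ∫ s, f s * Complex.exp (-(2 * Real.pi * Complex.I * ω₀ * s)) := by
    rw [Real.fourier_eq']
    refine integral_congr_ae (.of_forall fun s => ?_)
    simp only [smul_eq_mul, mul_comm (f s)]
    congr 2
    simp
    ring
  have hmeas : StronglyMeasurable fun a : ℝ => ∫ t, ‖K t - K (t - a)‖ := by
    have := K.continuous
    exact StronglyMeasurable.integral_prod_right (f := fun a t => ‖K t - K (t - a)‖)
      (Continuous.stronglyMeasurable (by fun_prop))
  have hi3 : Integrable fun s => ‖f s‖ * ∫ t, ‖K t - K (t - ε * s)‖ := by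
    refine (hf.norm.mul_const (2 * ∫ t, ‖K t‖)).mono' (hf.norm.aestronglyMeasurable.mul
      (hmeas.comp_measurable (by fun_prop)).aestronglyMeasurable) (.of_forall fun s => ?_)
    rw [norm_mul, norm_norm, Real.norm_of_nonneg (integral_nonneg fun t => norm_nonneg _)]
    exact mul_le_mul_of_nonneg_left (K.integral_norm_sub_translate_le _) (norm_nonneg _)
  rw [hF, ← integral_smul_const, moduleAction, ← integral_sub (hi2.smul_const M) hi1,
    ← integral_mul_const]
  refine norm_integral_le_of_norm_le (hi3.mul_const _) (.of_forall fun s => ?_)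
  rw [mul_smul, ← smul_sub, norm_smul]
  exact (mul_le_mul_of_nonneg_left (hcomp s) (norm_nonneg (f s))).trans_eq (mul_assoc _ _ _).symm

/-- A smooth bump which is `1` on `[-r, r]` and `0` outside `(-R, R)`, as a Schwartz function. -/
theorem _root_.SchwartzMap.exists_bump {r R : ℝ} (hr : 0 < r) (hrR : r < R) :
    ∃ φ : 𝓢(ℝ, ℂ), (∀ ω, |ω| ≤ r → φ ω = 1) ∧ (∀ ω, R ≤ |ω| → φ ω = 0) := by
  let b : ContDiffBump (0 : ℝ) := ⟨r, R, hr, hrR⟩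
  have hb : ContDiff ℝ (⊤ : ℕ∞) fun ω => (b ω : ℂ) :=
    Complex.ofRealCLM.contDiff.comp b.contDiff
  have hs : HasCompactSupport fun ω => (b ω : ℂ) :=
    b.hasCompactSupport.comp_left (g := Complex.ofReal) rfl
  refine ⟨hs.toSchwartzMap hb, fun ω hω => ?_, fun ω hω => ?_⟩
  · have : b ω = 1 := b.one_of_mem_closedBall (by simpa [b] using hω)
    simp [this]
  · have : b ω = 0 := b.zero_of_le_dist (by simpa [b] using hω)
    simp [this]

/-- A local substitute for division by `𝓕 f`. As `f` acts by zero, the narrow cutoff at `ω₀` has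
operator norm at most `1/2`; it also fixes every symbol supported where it equals `1`, and a vector
fixed by such an operator is zero. -/
theorem exists_multiplier_eq_zero_of_support [CompleteSpace E] (hT : IsIsometricRep T)
    {f : ℝ → ℂ} (hf : Integrable f) (hfT : ∀ v, moduleAction T f v = 0) {ω₀ : ℝ}
    (hω₀ : 𝓕 f ω₀ ≠ 0) :
    ∃ ε > 0, ∀ φ : 𝓢(ℝ, ℂ), (∀ ω, φ ω ≠ 0 → |ω - ω₀| ≤ ε) → ∀ v, hT.multiplier v φ = 0 := by
  obtain ⟨V, hV, -⟩ := SchwartzMap.exists_bump one_pos one_lt_two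
  have hlim := (𝓕⁻ V : 𝓢(ℝ, ℂ)).tendsto_integral_norm_mul_translate hf
  have hc : 0 < ‖𝓕 f ω₀‖ := norm_pos_iff.2 hω₀
  have hev := (hlim.mono_left nhdsWithin_le_nhds).eventually
    (gt_mem_nhds (half_pos hc)) |>.and (self_mem_nhdsWithin (a := (0 : ℝ)) (s := Set.Ioi 0))
  obtain ⟨ε, hε1, hε⟩ := hev.exists
  have hε : 0 < ε := hε
  have hhalf : ∀ u : E, ‖hT.multiplier u (V.rescale ω₀ ε hε.ne')‖ ≤ ‖u‖ / 2 := by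
    intro u
    have h := hT.norm_smul_multiplier_rescale_sub_le hf V ω₀ hε u
    rw [hfT, sub_zero, norm_smul] at h
    have h2 := h.trans (mul_le_mul_of_nonneg_right hε1.le (norm_nonneg u))
    rw [div_mul_eq_mul_div, mul_div_assoc] at h2
    exact le_of_mul_le_mul_left h2 hc
  refine ⟨ε, hε, fun φ hφ v => ?_⟩
  have hmul : SchwartzMap.pairing (ContinuousLinearMap.mul ℂ ℂ) (V.rescale ω₀ ε hε.ne') φ = φ := by
    ext ω
    rw [SchwartzMap.pairing_apply_apply, ContinuousLinearMap.mul_apply']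
    by_cases h : φ ω = 0
    · simp [h]
    · rw [SchwartzMap.rescale_apply, hV, one_mul]
      rw [abs_div, abs_of_pos hε, div_le_one hε]
      exact hφ ω h
  have h := hT.multiplier_pairing v (V.rescale ω₀ ε hε.ne') φ
  rw [hmul] at h
  have h2 := hhalf (hT.multiplier v φ)
  rw [← h] at h2
  have := norm_nonneg (hT.multiplier v φ)
  exact norm_le_zero_iff.1 (by linarith)

/-- Compactness and a smooth partition of unity reduce this to the local statement. The factor `2π`
converts from the frequency normalization of `𝓕` to that of `fourierHat`. -/
theorem multiplier_eq_zero_of_tsupport [CompleteSpace E] (hT : IsIsometricRep T) (φ : 𝓢(ℝ, ℂ))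
    (hc : HasCompactSupport φ)
    (hφ : ∀ ω ∈ tsupport φ, 2 * Real.pi * ω ∉ beurlingSpectrum T Set.univ) (v : E) :
    hT.multiplier v φ = 0 := by
  have hloc : ∀ ω : ℝ, ∃ ε > 0, ω ∈ tsupport φ → ∀ ψ : 𝓢(ℝ, ℂ),
      (∀ ω', ψ ω' ≠ 0 → |ω' - ω| ≤ ε) → ∀ v, hT.multiplier v ψ = 0 := by
    intro ω
    by_cases hω : ω ∈ tsupport φ
    · have h := hφ ω hω
      simp only [beurlingSpectrum, Set.mem_ofPred_eq, not_forall] at h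
      obtain ⟨f, hf, hfT, hne⟩ := h
      rw [fourierHat_eq_fourier, mul_div_cancel_left₀ _ (by positivity)] at hne
      obtain ⟨ε, hε, h⟩ :=
        hT.exists_multiplier_eq_zero_of_support hf (fun v => hfT v (Set.mem_univ _)) hne
      exact ⟨ε, hε, fun _ => h⟩
    · exact ⟨1, one_pos, fun h => absurd h hω⟩
  choose ε hε hloc using hloc
  obtain ⟨s, hs, hcov⟩ := hc.elim_nhds_subcover (fun ω => Metric.ball ω (ε ω))
    (fun ω _ => Metric.ball_mem_nhds ω (hε ω))
  obtain ⟨ρ, hρ⟩ := SmoothPartitionOfUnity.exists_isSubordinate (modelWithCornersSelf ℝ ℝ)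
    (isClosed_tsupport φ) (fun i : s => Metric.ball (i : ℝ) (ε i))
    (fun i => Metric.isOpen_ball) (by simpa [Set.iUnion_subtype] using hcov)
  have hsm : ∀ i : s, ContDiff ℝ (⊤ : ℕ∞) fun ω => (ρ i ω : ℂ) * φ ω := fun i =>
    (Complex.ofRealCLM.contDiff.comp (contMDiff_iff_contDiff.1 (ρ i).contMDiff)).mul φ.smooth'
  have hcs : ∀ i : s, HasCompactSupport fun ω => (ρ i ω : ℂ) * φ ω := fun i => hc.mul_left
  have hsum : φ = ∑ i : s, (hcs i).toSchwartzMap (hsm i) := by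
    ext ω
    rw [sum_apply]
    simp only [HasCompactSupport.toSchwartzMap_toFun]
    rw [← Finset.sum_mul]
    by_cases h : φ ω = 0
    · simp [h]
    · have h1 := ρ.sum_eq_one (subset_tsupport _ h)
      rw [finsum_eq_sum_of_fintype] at h1
      rw [← Complex.ofReal_sum, h1]
      simp
  rw [hsum, map_sum]
  refine Finset.sum_eq_zero fun i _ => hloc i (hs i i.2) _ (fun ω hω => ?_) v
  have h1 : ρ i ω ≠ 0 := by
    intro h
    simp [h] at hω
  have h2 := hρ i (subset_tsupport _ h1)
  exact (Metric.mem_ball.1 h2).le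

/-- If the spectrum is contained in a compact interval, the Fourier multiplier equal to `1` near
that interval acts as the identity. -/
theorem multiplier_eq_self [CompleteSpace E] (hT : IsIsometricRep T) {γ : ℝ}
    (hspec : beurlingSpectrum T Set.univ ⊆ Set.Icc (-γ) γ) (κ : 𝓢(ℝ, ℂ)) {r R : ℝ}
    (hr : 0 < r) (hγr : γ < 2 * Real.pi * r) (hκ1 : ∀ ω, |ω| ≤ r → κ ω = 1)
    (hκ0 : ∀ ω, R ≤ |ω| → κ ω = 0) (v : E) : hT.multiplier v κ = v := by
  -- Widening the cutoff changes it only on `r ≤ |ω|`, off the spectrum, so the operator is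
  -- unchanged. As `ε → ∞` the kernels form an approximate identity of total mass `κ 0 = 1`.
  have hn : ∀ ε : ℝ, ∀ hε : 1 ≤ ε,
      hT.multiplier v (κ.rescale 0 ε (one_pos.trans_le hε).ne') = hT.multiplier v κ := by
    intro ε hε
    have hε0 : 0 < ε := one_pos.trans_le hε
    rw [← sub_eq_zero, ← map_sub]
    refine hT.multiplier_eq_zero_of_tsupport _ ?_ ?_ v
    · refine HasCompactSupport.intro (isCompact_Icc (a := -(R * ε)) (b := R * ε)) fun ω hω => ?_
      have h1 : R * ε < |ω| := by
        by_contra! h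
        exact hω (abs_le.1 h)
      have hR : 0 ≤ R := by
        by_contra! h
        have e0 := hκ0 0 (by simpa using h.le)
        have e1 := hκ1 0 (by simpa using hr.le)
        exact one_ne_zero (e1.symm.trans e0)
      rw [sub_apply, SchwartzMap.rescale_apply, hκ0, hκ0, sub_zero]
      · nlinarith
      · rw [sub_zero, abs_div, abs_of_pos hε0, le_div_iff₀ hε0]
        exact h1.le
    · intro ω hω hmem
      have hsub : tsupport (κ.rescale 0 ε hε0.ne' - κ) ⊆ {ω | r ≤ |ω|} := by
        refine closure_minimal (fun ω hω => ?_) (isClosed_le continuous_const continuous_abs)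
        by_contra! h
        simp only [Set.mem_ofPred_eq, not_le] at h
        refine hω ?_
        rw [sub_apply, SchwartzMap.rescale_apply, hκ1, hκ1 _ h.le, sub_self]
        rw [sub_zero, abs_div, abs_of_pos hε0, div_le_iff₀ hε0]
        nlinarith
      have h1 : r ≤ |ω| := hsub hω
      have h2 := abs_le.2 (hspec hmem)
      rw [abs_mul, abs_of_pos Real.two_pi_pos] at h2
      have := mul_le_mul_of_nonneg_left h1 Real.two_pi_pos.le
      linarith
  have hlim : Tendsto (fun ε : ℝ => ∫ t, (𝓕⁻ κ : 𝓢(ℝ, ℂ)) t • T (-(ε⁻¹ * t)) v) atTop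
      (𝓝 (∫ t, (𝓕⁻ κ : 𝓢(ℝ, ℂ)) t • v)) := by
    have hi : Integrable (𝓕⁻ κ : 𝓢(ℝ, ℂ)) := SchwartzMap.integrable _
    refine tendsto_integral_filter_of_dominated_convergence
      (fun t => ‖(𝓕⁻ κ : 𝓢(ℝ, ℂ)) t‖ * ‖v‖) ?_ ?_ (hi.norm.mul_const _) ?_
    · filter_upwards with ε
      exact hi.aestronglyMeasurable.smul
        ((hT.continuous_orbit v).comp (by fun_prop)).aestronglyMeasurable
    · filter_upwards with ε
      filter_upwards with t
      rw [norm_smul, hT.norm_map]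
    · filter_upwards with t
      have h1 : Tendsto (fun ε : ℝ => -(ε⁻¹ * t)) atTop (𝓝 0) := by
        simpa using (tendsto_inv_atTop_zero.mul_const t).neg
      have h2 := ((hT.continuous_orbit v).tendsto 0).comp h1
      rw [hT.map_zero] at h2
      exact h2.const_smul _
  have hint : ∫ t, (𝓕⁻ κ : 𝓢(ℝ, ℂ)) t = 1 := by
    have h1 : (𝓕 (𝓕⁻ κ : 𝓢(ℝ, ℂ)) : 𝓢(ℝ, ℂ)) 0 = κ 0 := by simp
    rw [hκ1 0 (by simpa using hr.le), SchwartzMap.fourier_coe, Real.fourier_eq'] at h1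
    simpa using h1
  rw [integral_smul_const, hint, one_smul] at hlim
  refine tendsto_nhds_unique (tendsto_const_nhds.congr' ?_) hlim
  filter_upwards [eventually_ge_atTop 1] with ε hε
  rw [← hn ε hε, hT.multiplier_rescale_apply κ 0 (one_pos.trans_le hε)]
  simp

/-- If the spectrum lies inside `(-γ', γ')`, an absolutely convergent expansion of `ξ ↦ exp (i s ξ)`
into exponentials on `[-γ', γ']` gives the corresponding expansion of `T s`. -/
theorem hasSum_smul_of_hasSum_exp [CompleteSpace E] (hT : IsIsometricRep T) {γ γ' : ℝ}
    (hspec : beurlingSpectrum T Set.univ ⊆ Set.Icc (-γ) γ) (hγ : 0 < γ) (hγ' : γ < γ')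
    {ι : Type*} [Countable ι] {a : ι → ℂ} (ha : Summable fun i => ‖a i‖) (μ : ι → ℝ) (s : ℝ)
    (h : ∀ ξ : ℝ, |ξ| ≤ γ' → HasSum (fun i => a i * Complex.exp (Complex.I * μ i * ξ))
      (Complex.exp (Complex.I * s * ξ))) (v : E) :
    HasSum (fun i => a i • T (μ i) v) (T s v) := by
  have hpi := Real.pi_pos
  have hγ'0 : 0 < γ' := hγ.trans hγ'
  -- In the variable `ξ = 2πω` the cutoff is `1` up to the midpoint of `γ` and `γ'`, and `0` from
  -- `γ'` on.
  obtain ⟨κ, hκ1, hκ0⟩ := SchwartzMap.exists_bump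
    (r := (γ + γ') / (4 * Real.pi)) (R := γ' / (2 * Real.pi)) (by positivity) (by
      rw [div_lt_div_iff₀ (by positivity) (by positivity)]
      nlinarith)
  have hv : moduleAction T (𝓕⁻ κ : 𝓢(ℝ, ℂ)) v = v := by
    refine hT.multiplier_eq_self hspec κ (by positivity) ?_ hκ1 hκ0 v
    field_simp
    linarith
  set K : 𝓢(ℝ, ℂ) := 𝓕⁻ κ with hK
  have hKi : Integrable K := K.integrable
  have hTK : ∀ s : ℝ, T s v = ∫ t, K (s + t) • T (-t) v := fun s => by
    conv_lhs => rw [← hv]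
    exact hT.map_moduleAction' hKi s v
  have hKx : ∀ x : ℝ, K x = ∫ ω : ℝ, Complex.exp (2 * Real.pi * Complex.I * ω * x) * κ ω := by
    intro x
    rw [hK, SchwartzMap.fourierInv_coe, Real.fourierInv_eq']
    refine integral_congr_ae (.of_forall fun ω => ?_)
    simp only [smul_eq_mul]
    congr 2
    simp
    ring
  -- `K` has frequencies only in the interval where the exponential expansion is assumed, so its
  -- translates obey the same expansion.
  have hpt : ∀ t : ℝ, HasSum (fun i => a i * K (μ i + t)) (K (s + t)) := by
    intro t
    simp only [hKx, ← integral_const_mul]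
    have hnorm : ∀ x ω : ℝ, ‖Complex.exp (2 * Real.pi * Complex.I * ω * x)‖ = 1 := by
      intro x ω
      rw [Complex.norm_exp]
      simp
    refine hasSum_integral_of_dominated_convergence (fun i ω => ‖a i‖ * ‖κ ω‖) ?_ ?_ ?_ ?_ ?_
    · intro i
      have := κ.continuous
      exact Continuous.aestronglyMeasurable (by fun_prop)
    · intro i
      filter_upwards with ω
      rw [norm_mul, norm_mul, hnorm, one_mul]
    · filter_upwards with ω
      exact ha.mul_right _
    · simp only [tsum_mul_right]
      exact κ.integrable.norm.const_mul _
    · filter_upwards with ω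
      by_cases hω : κ ω = 0
      · simp [hω]
      · have h1 : |ω| < γ' / (2 * Real.pi) := by
          by_contra! hle
          exact hω (hκ0 ω hle)
        have h2 : |2 * Real.pi * ω| ≤ γ' := by
          rw [abs_mul, abs_of_pos Real.two_pi_pos]
          rw [lt_div_iff₀ Real.two_pi_pos] at h1
          linarith
        have h3 := (h _ h2).mul_right (Complex.exp (2 * Real.pi * Complex.I * ω * t) * κ ω)
        have e : ∀ x : ℝ, Complex.exp (Complex.I * x * ((2 * Real.pi * ω : ℝ) : ℂ)) *
            (Complex.exp (2 * Real.pi * Complex.I * ω * t) * κ ω) =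
            Complex.exp (2 * Real.pi * Complex.I * ω * ((x + t : ℝ) : ℂ)) * κ ω := by
          intro x
          rw [← mul_assoc, ← Complex.exp_add]
          congr 2
          push_cast
          ring
        simpa only [mul_assoc (a _), e] using h3
  have hFi : ∀ i, Integrable fun t => (a i * K (μ i + t)) • T (-t) v := fun i =>
    hT.integrable_smul_orbit ((hKi.comp_add_left (μ i)).const_mul _) v
  have hsum := hasSum_integral_of_summable_integral_norm hFi (by
    refine (ha.mul_right ((∫ t, ‖K t‖) * ‖v‖)).congr fun i => ?_
    simp only [norm_smul, norm_mul, hT.norm_map]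
    rw [integral_mul_const, integral_const_mul, integral_add_left_eq_self (fun t => ‖K t‖),
      mul_assoc])
  convert hsum using 1
  · ext i
    rw [hTK, ← integral_smul]
    simp only [smul_smul]
  · rw [hTK]
    refine integral_congr_ae (.of_forall fun t => ?_)
    exact ((hpt t).smul_const (T (-t) v)).tsum_eq.symm

end IsIsometricRep

/-! ### Fourier expansions of cosine and sine with integer and half-integer frequencies. -/

theorem hasSum_fourier_on_Icc {f : ℝ → ℂ} (hf : Continuous f) (hper : f (-Real.pi) = f Real.pi)
    {c : ℤ → ℂ} (hc : ∀ n, c n = (1 / (2 * Real.pi) : ℝ) *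
      ∫ θ in -Real.pi..Real.pi, Complex.exp (-(Complex.I * n * θ)) * f θ)
    (hs : Summable c) {θ : ℝ} (hθ : |θ| ≤ Real.pi) :
    HasSum (fun n => c n * Complex.exp (Complex.I * n * θ)) (f θ) := by
  have : Fact (0 < 2 * Real.pi) := ⟨Real.two_pi_pos⟩
  have hend : -Real.pi + 2 * Real.pi = Real.pi := by ring
  have hpi : (Real.pi : ℂ) ≠ 0 := by exact_mod_cast Real.pi_ne_zero
  let F : C(AddCircle (2 * Real.pi), ℂ) := ⟨AddCircle.liftIco (2 * Real.pi) (-Real.pi) f,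
    AddCircle.liftIco_continuous (by rw [hend, hper]) hf.continuousOn⟩
  have hFc : fourierCoeff F = c := by
    ext n
    have h1 := fourierCoeff_liftIco_eq (T := 2 * Real.pi) (a := -Real.pi) f n
    change fourierCoeff (AddCircle.liftIco (2 * Real.pi) (-Real.pi) f) n = c n
    rw [h1, fourierCoeffOn_eq_integral, hc, Complex.real_smul]
    congr 1
    · rw [add_sub_cancel_left]
    · rw [hend]
      refine intervalIntegral.integral_congr fun θ _ => ?_
      simp only [smul_eq_mul, fourier_coe_apply]
      congr 2
      push_cast
      field_simp
      ring_nf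
  have hsum : ∀ θ : ℝ, HasSum (fun n => c n * Complex.exp (Complex.I * n * θ))
      (F (θ : AddCircle (2 * Real.pi))) := by
    intro θ
    have h := has_pointwise_sum_fourier_series_of_summable (f := F) (by rwa [hFc])
      (θ : AddCircle (2 * Real.pi))
    rw [hFc] at h
    convert h using 2 with n
    rw [smul_eq_mul, fourier_coe_apply]
    congr 2
    push_cast
    field_simp
  convert hsum θ using 1
  have hθ' := abs_le.1 hθ
  have key : ∀ x ∈ Set.Ico (-Real.pi) (-Real.pi + 2 * Real.pi),
      F (x : AddCircle (2 * Real.pi)) = f x := fun x hx => AddCircle.liftIco_coe_apply hx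
  rcases hθ'.2.lt_or_eq with h | h
  · exact (key θ ⟨hθ'.1, by rwa [hend]⟩).symm
  · have h2 : (θ : AddCircle (2 * Real.pi)) = ((-Real.pi : ℝ) : AddCircle (2 * Real.pi)) := by
      rw [h, ← AddCircle.coe_add_period (2 * Real.pi) (-Real.pi), hend]
    rw [h2, key _ ⟨le_rfl, by linarith [Real.pi_pos]⟩, hper, h]

theorem integral_exp_I_mul (c : ℝ) :
    ∫ θ in -Real.pi..Real.pi, Complex.exp (Complex.I * c * θ) =
      2 * Real.pi * Real.sinc (Real.pi * c) := by
  by_cases hc : c = 0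
  · simp [hc]
    ring
  · have h := intervalIntegral.integral_comp_mul_left
      (fun t : ℝ => Complex.exp (t * Complex.I)) (a := -Real.pi) (b := Real.pi) hc
    rw [mul_neg, integral_exp_mul_I_eq_sinc] at h
    have hc' : (c : ℂ) ≠ 0 := by exact_mod_cast hc
    have e : ∀ θ : ℝ, Complex.I * c * θ = ((c * θ : ℝ) : ℂ) * Complex.I := by
      intro θ; push_cast; ring
    simp only [e, h, Complex.real_smul, mul_comm Real.pi c]
    push_cast
    field_simp

/-- The coefficient of `exp (i m θ)` in the expansion of `(exp (i τ θ) + σ exp (-i τ θ)) / 2`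
on `[-π, π]`. -/
noncomputable def expCoeff (σ τ m : ℝ) : ℝ :=
  (Real.sinc (Real.pi * (τ - m)) + σ * Real.sinc (Real.pi * (τ + m))) / 2

/-- Multiplication by `exp (ihθ)` turns an expansion in the shifted frequencies `n - h` into an
ordinary Fourier series; `hper` is the matching of endpoint values this requires. It is used with `σ
= 1, h = 0` (cosine) and `σ = -1, h = 1/2` (sine). -/
theorem hasSum_expCoeff {σ h τ : ℝ}
    (hper : Complex.exp (Complex.I * h * Real.pi) * (Complex.exp (Complex.I * τ * Real.pi) +
        σ * Complex.exp (-(Complex.I * τ * Real.pi))) =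
      Complex.exp (-(Complex.I * h * Real.pi)) * (Complex.exp (-(Complex.I * τ * Real.pi)) +
        σ * Complex.exp (Complex.I * τ * Real.pi)))
    (hs : Summable fun n : ℤ => expCoeff σ τ (n - h)) {θ : ℝ} (hθ : |θ| ≤ Real.pi) :
    HasSum (fun n : ℤ => (expCoeff σ τ (n - h) : ℂ) *
        Complex.exp (Complex.I * ((n - h : ℝ) : ℂ) * θ))
      ((Complex.exp (Complex.I * τ * θ) + σ * Complex.exp (-(Complex.I * τ * θ))) / 2) := by
  have hpi : (Real.pi : ℂ) ≠ 0 := by exact_mod_cast Real.pi_ne_zero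
  have key := hasSum_fourier_on_Icc (f := fun θ : ℝ => Complex.exp (Complex.I * h * θ) *
      ((Complex.exp (Complex.I * τ * θ) + σ * Complex.exp (-(Complex.I * τ * θ))) / 2))
    (c := fun n : ℤ => (expCoeff σ τ (n - h) : ℂ)) (by fun_prop) (by
      rw [← mul_div_assoc, ← mul_div_assoc, hper]
      simp) (fun n => ?_) (by exact_mod_cast hs) hθ
  · have h2 := key.mul_left (Complex.exp (-(Complex.I * h * θ)))
    rw [← mul_assoc, ← Complex.exp_add, neg_add_cancel, Complex.exp_zero, one_mul] at h2
    have e : (fun n : ℤ => (expCoeff σ τ (n - h) : ℂ) *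
        Complex.exp (Complex.I * ((n - h : ℝ) : ℂ) * θ)) = fun n : ℤ =>
          Complex.exp (-(Complex.I * h * θ)) *
            ((expCoeff σ τ (n - h) : ℂ) * Complex.exp (Complex.I * n * θ)) := ?_
    · rw [e]; exact h2
    ext n
    rw [mul_left_comm, ← Complex.exp_add]
    congr 2
    push_cast
    ring
  · have e : ∀ θ : ℝ, Complex.exp (-(Complex.I * n * θ)) * (Complex.exp (Complex.I * h * θ) *
      ((Complex.exp (Complex.I * τ * θ) + σ * Complex.exp (-(Complex.I * τ * θ))) / 2)) =
        1 / 2 * Complex.exp (Complex.I * ((τ - (n - h) : ℝ) : ℂ) * θ) +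
        σ / 2 * Complex.exp (Complex.I * ((-(τ + (n - h)) : ℝ) : ℂ) * θ) := by
      intro θ
      have e1 : Complex.exp (Complex.I * ((τ - (n - h) : ℝ) : ℂ) * θ) =
          Complex.exp (-(Complex.I * n * θ)) * Complex.exp (Complex.I * h * θ) *
            Complex.exp (Complex.I * τ * θ) := by
        rw [← Complex.exp_add, ← Complex.exp_add]
        congr 1
        push_cast
        ring
      have e2 : Complex.exp (Complex.I * ((-(τ + (n - h)) : ℝ) : ℂ) * θ) =
          Complex.exp (-(Complex.I * n * θ)) * Complex.exp (Complex.I * h * θ) *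
            Complex.exp (-(Complex.I * τ * θ)) := by
        rw [← Complex.exp_add, ← Complex.exp_add]
        congr 1
        push_cast
        ring
      rw [e1, e2]
      ring
    simp only [e]
    rw [intervalIntegral.integral_add, intervalIntegral.integral_const_mul,
      intervalIntegral.integral_const_mul, integral_exp_I_mul, integral_exp_I_mul, mul_neg,
      Real.sinc_neg, expCoeff]
    · push_cast
      field_simp
    · exact Continuous.intervalIntegrable (by fun_prop) _ _
    · exact Continuous.intervalIntegrable (by fun_prop) _ _

theorem summable_inv_int_sub_sq (h : ℝ) : Summable fun n : ℤ => ((n - h : ℝ) ^ 2)⁻¹ := by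
  have := (Real.summable_one_div_int_add_rpow (-h) 2).2 one_lt_two
  refine this.congr fun n => ?_
  rw [one_div, ← sub_eq_add_neg]
  norm_cast
  rw [sq_abs]

/-- When the two sinc numerators agree, the terms of order `1/m` cancel. The resulting quadratic
decay gives absolute convergence. -/
theorem expCoeff_eq {σ τ m S : ℝ} (h1 : τ - m ≠ 0) (h2 : τ + m ≠ 0)
    (hS1 : Real.sin (Real.pi * (τ - m)) = S) (hS2 : σ * Real.sin (Real.pi * (τ + m)) = S) :
    expCoeff σ τ m = S * τ / (Real.pi * (τ ^ 2 - m ^ 2)) := by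
  have hpi := Real.pi_ne_zero
  have h3 : τ ^ 2 - m ^ 2 = (τ - m) * (τ + m) := by ring
  rw [expCoeff, Real.sinc_of_ne_zero (by positivity), Real.sinc_of_ne_zero (by positivity),
    ← mul_div_assoc, hS1, hS2, h3]
  field_simp
  ring

theorem expCoeff_one_int {τ : ℝ} (hτ : |τ| < 1) {n : ℤ} (hn : n ≠ 0) :
    expCoeff 1 τ n = -((-1) ^ n * (τ * Real.sin (Real.pi * τ) / (Real.pi * (n ^ 2 - τ ^ 2)))) := by
  have hn1 : (1 : ℝ) ≤ |(n : ℝ)| := by exact_mod_cast Int.one_le_abs hn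
  have h1 : τ - n ≠ 0 := fun h => by
    rw [sub_eq_zero.1 h] at hτ; linarith
  have h2 : τ + n ≠ 0 := fun h => by
    rw [eq_neg_of_add_eq_zero_left h, abs_neg] at hτ; linarith
  rw [expCoeff_eq (S := (-1) ^ n * Real.sin (Real.pi * τ)) h1 h2, ← neg_sub ((n : ℝ) ^ 2),
    mul_neg, div_neg]
  · ring
  · rw [mul_sub, mul_comm Real.pi (n : ℝ), Real.sin_sub_int_mul_pi]
  · rw [one_mul, mul_add, mul_comm Real.pi (n : ℝ), Real.sin_add_int_mul_pi]

theorem expCoeff_neg_one_half {τ : ℝ} (hτ : |τ| < 1 / 2) (n : ℤ) :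
    expCoeff (-1) τ (n - 1 / 2) = -((-1) ^ n * (τ * Real.cos (Real.pi * τ) /
      (Real.pi * ((n - 1 / 2 : ℝ) ^ 2 - τ ^ 2)))) := by
  have hn1 : 1 / 2 ≤ |(n - 1 / 2 : ℝ)| := by
    rcases le_or_gt n 0 with h | h
    · have : (n : ℝ) ≤ 0 := by exact_mod_cast h
      rw [abs_of_neg (by linarith)]; linarith
    · have : (1 : ℝ) ≤ n := by exact_mod_cast h
      rw [abs_of_nonneg (by linarith)]; linarith
  have h1 : τ - (n - 1 / 2) ≠ 0 := fun h => by
    rw [sub_eq_zero.1 h] at hτ; linarith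
  have h2 : τ + (n - 1 / 2) ≠ 0 := fun h => by
    rw [eq_neg_of_add_eq_zero_left h, abs_neg] at hτ; linarith
  rw [expCoeff_eq (S := (-1) ^ n * Real.cos (Real.pi * τ)) h1 h2,
    ← neg_sub ((n - 1 / 2 : ℝ) ^ 2), mul_neg, div_neg]
  · ring
  · have : Real.pi * (τ - (n - 1 / 2)) = Real.pi * τ + Real.pi / 2 - n * Real.pi := by ring
    rw [this, Real.sin_sub_int_mul_pi, Real.sin_add_pi_div_two]
  · have : Real.pi * (τ + (n - 1 / 2)) = Real.pi * τ - Real.pi / 2 + n * Real.pi := by ring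
    rw [this, Real.sin_add_int_mul_pi, Real.sin_sub_pi_div_two]
    ring

theorem abs_expCoeff_one_int {τ : ℝ} (hτ : |τ| ≤ 1 / 4) {n : ℤ} (hn : n ≠ 0) :
    |expCoeff 1 τ n| = |τ| * Real.sin (Real.pi * |τ|) / (Real.pi * ((n : ℝ) ^ 2 - |τ| ^ 2)) := by
  have hn1 : (1 : ℝ) ≤ (n : ℝ) ^ 2 := by
    have : (1 : ℝ) ≤ |(n : ℝ)| := by exact_mod_cast Int.one_le_abs hn
    nlinarith [sq_abs (n : ℝ)]
  have hs : 0 ≤ Real.sin (Real.pi * |τ|) :=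
    Real.sin_nonneg_of_nonneg_of_le_pi (by positivity) (by nlinarith [Real.pi_pos])
  have h1 : τ * Real.sin (Real.pi * τ) = |τ| * Real.sin (Real.pi * |τ|) := by
    rcases abs_choice τ with h | h <;> simp [h]
  have hd : 0 < (n : ℝ) ^ 2 - |τ| ^ 2 := by nlinarith [abs_nonneg τ]
  rw [expCoeff_one_int (by linarith) hn, abs_neg, abs_mul, abs_zpow, abs_neg, abs_one, one_zpow,
    one_mul, h1, ← sq_abs τ, abs_of_nonneg (by positivity)]

theorem quarter_le_int_sub_half_sq (n : ℤ) : (1 / 4 : ℝ) ≤ (n - 1 / 2 : ℝ) ^ 2 := by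
  have h : (0 : ℝ) ≤ n * (n - 1) := by
    have : 0 ≤ n * (n - 1) := by
      rcases le_or_gt n 0 with h | h <;> nlinarith
    exact_mod_cast this
  nlinarith

theorem cos_pi_mul_nonneg {t : ℝ} (h0 : 0 ≤ t) (h1 : t ≤ 1 / 4) : 0 ≤ Real.cos (Real.pi * t) :=
  Real.cos_nonneg_of_neg_pi_div_two_le_of_le (by nlinarith [Real.pi_pos])
    (by nlinarith [Real.pi_pos])

theorem abs_expCoeff_neg_one_half {τ : ℝ} (hτ : |τ| ≤ 1 / 4) (n : ℤ) :
    |expCoeff (-1) τ (n - 1 / 2)| = |τ| * Real.cos (Real.pi * |τ|) /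
      (Real.pi * ((n - 1 / 2 : ℝ) ^ 2 - |τ| ^ 2)) := by
  have hn1 := quarter_le_int_sub_half_sq n
  have hs : 0 ≤ Real.cos (Real.pi * |τ|) := cos_pi_mul_nonneg (abs_nonneg τ) hτ
  have h1 : Real.cos (Real.pi * τ) = Real.cos (Real.pi * |τ|) := by
    rcases abs_choice τ with h | h <;> simp [h]
  have hd : 0 < (n - 1 / 2 : ℝ) ^ 2 - |τ| ^ 2 := by nlinarith [abs_nonneg τ]
  rw [expCoeff_neg_one_half (by linarith), abs_neg, abs_mul, abs_zpow, abs_neg, abs_one, one_zpow,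
    one_mul, abs_div, abs_mul, h1, ← sq_abs τ, abs_of_nonneg hs, abs_of_pos (a := Real.pi * _)
    (by positivity)]

theorem mul_div_pi_mul_sub_le {t S q : ℝ} (h0 : 0 ≤ t) (h1 : t ≤ 1 / 4) (hS0 : 0 ≤ S) (hS1 : S ≤ 1)
    (hq : 1 / 4 ≤ q) : t * S / (Real.pi * (q - t ^ 2)) ≤ q⁻¹ := by
  have hd : q / 2 ≤ q - t ^ 2 := by nlinarith
  have hpi := Real.pi_gt_three
  rw [inv_eq_one_div, div_le_div_iff₀ (by nlinarith) (by linarith)]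
  have h2 : t * S ≤ 1 / 4 := by nlinarith
  have h3 : 3 * (q / 2) ≤ Real.pi * (q - t ^ 2) := mul_le_mul hpi.le hd (by linarith) (by linarith)
  nlinarith

theorem summable_expCoeff_one {τ : ℝ} (hτ : |τ| ≤ 1 / 4) :
    Summable fun n : ℤ => expCoeff 1 τ n := by
  refine Summable.of_norm_bounded_eventually (by simpa using summable_inv_int_sub_sq 0) ?_
  filter_upwards [(Set.finite_singleton (0 : ℤ)).compl_mem_cofinite] with n hn
  have hn : n ≠ 0 := hn
  have hn1 : (1 : ℝ) ≤ (n : ℝ) ^ 2 := by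
    have : (1 : ℝ) ≤ |(n : ℝ)| := by exact_mod_cast Int.one_le_abs hn
    nlinarith [sq_abs (n : ℝ)]
  rw [Real.norm_eq_abs, abs_expCoeff_one_int hτ hn]
  exact mul_div_pi_mul_sub_le (abs_nonneg τ) hτ (Real.sin_nonneg_of_nonneg_of_le_pi
    (by positivity) (by nlinarith [Real.pi_pos])) (Real.sin_le_one _) (by linarith)

theorem summable_expCoeff_neg_one {τ : ℝ} (hτ : |τ| ≤ 1 / 4) :
    Summable fun n : ℤ => expCoeff (-1) τ (n - 1 / 2) := by
  refine Summable.of_norm_bounded (summable_inv_int_sub_sq (1 / 2)) fun n => ?_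
  rw [Real.norm_eq_abs, abs_expCoeff_neg_one_half hτ]
  exact mul_div_pi_mul_sub_le (abs_nonneg τ) hτ (cos_pi_mul_nonneg (abs_nonneg τ) hτ)
    (Real.cos_le_one _) (quarter_le_int_sub_half_sq n)

theorem hasSum_expCoeff_one {τ : ℝ} (hτ : |τ| ≤ 1 / 4) {θ : ℝ} (hθ : |θ| ≤ Real.pi) :
    HasSum (fun n : ℤ => (expCoeff 1 τ n : ℂ) * Complex.exp (Complex.I * ((n : ℝ) : ℂ) * θ))
      ((Complex.exp (Complex.I * τ * θ) + Complex.exp (-(Complex.I * τ * θ))) / 2) := by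
  have h := hasSum_expCoeff (σ := 1) (h := 0) (τ := τ) (by simp [add_comm])
    (by simpa using summable_expCoeff_one hτ) hθ
  simpa only [sub_zero, Complex.ofReal_one, one_mul] using h

theorem hasSum_expCoeff_neg_one {τ : ℝ} (hτ : |τ| ≤ 1 / 4) {θ : ℝ} (hθ : |θ| ≤ Real.pi) :
    HasSum (fun n : ℤ => (expCoeff (-1) τ (n - 1 / 2) : ℂ) *
        Complex.exp (Complex.I * ((n - 1 / 2 : ℝ) : ℂ) * θ))
      ((Complex.exp (Complex.I * τ * θ) - Complex.exp (-(Complex.I * τ * θ))) / 2) := by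
  have e : Complex.exp (Complex.I * ((1 / 2 : ℝ) : ℂ) * Real.pi) = Complex.I := by
    have e0 : Complex.I * ((1 / 2 : ℝ) : ℂ) * Real.pi = Real.pi / 2 * Complex.I := by
      push_cast
      ring
    rw [e0, Complex.exp_pi_div_two_mul_I]
  have h := hasSum_expCoeff (σ := -1) (h := 1 / 2) (τ := τ) (by
    rw [Complex.exp_neg (Complex.I * ((1 / 2 : ℝ) : ℂ) * Real.pi), e, Complex.inv_I]
    push_cast
    ring) (summable_expCoeff_neg_one hτ) hθ
  simpa only [Complex.ofReal_neg, Complex.ofReal_one, neg_one_mul, ← sub_eq_add_neg] using h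

/-! ### Kadec's majorant. -/

theorem exp_I_mul_int_mul_pi (n : ℤ) :
    Complex.exp (Complex.I * ((n : ℝ) : ℂ) * Real.pi) = (-1) ^ n := by
  rw [← Complex.exp_pi_mul_I, ← Complex.exp_int_mul]
  congr 1
  push_cast
  ring

/-- Evaluation at `θ = π`, where the exponentials become the signs that make all terms with `n ≠ 0`
of one sign when `τ ≥ 0`. It thus computes a sum of absolute values in closed form. -/
theorem hasSum_alternating_expCoeff_one {τ : ℝ} (hτ : |τ| ≤ 1 / 4) :
    HasSum (fun n : ℤ => (-1) ^ n * expCoeff 1 τ n) (Real.cos (Real.pi * τ)) := by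
  have h := hasSum_expCoeff_one hτ (θ := Real.pi) (by rw [abs_of_pos Real.pi_pos])
  simp only [exp_I_mul_int_mul_pi] at h
  have e : ((Real.cos (Real.pi * τ) : ℝ) : ℂ) =
      (Complex.exp (Complex.I * τ * Real.pi) + Complex.exp (-(Complex.I * τ * Real.pi))) / 2 := by
    rw [Complex.ofReal_cos, Complex.cos]
    push_cast
    ring_nf
  rw [← e] at h
  rw [← Complex.hasSum_ofReal]
  simpa [mul_comm] using h

theorem hasSum_alternating_expCoeff_neg_one {τ : ℝ} (hτ : |τ| ≤ 1 / 4) :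
    HasSum (fun n : ℤ => -((-1) ^ n * expCoeff (-1) τ (n - 1 / 2))) (Real.sin (Real.pi * τ)) := by
  have h := hasSum_expCoeff_neg_one hτ (θ := Real.pi) (by rw [abs_of_pos Real.pi_pos])
  have e1 : ∀ n : ℤ, Complex.exp (Complex.I * ((n - 1 / 2 : ℝ) : ℂ) * Real.pi) =
      (-1) ^ n * -Complex.I := by
    intro n
    rw [← exp_I_mul_int_mul_pi, ← Complex.exp_neg_pi_div_two_mul_I, ← Complex.exp_add]
    apply congrArg
    push_cast
    ring
  simp only [e1] at h
  have e : ((Real.sin (Real.pi * τ) : ℝ) : ℂ) = -Complex.I *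
      ((Complex.exp (Complex.I * τ * Real.pi) - Complex.exp (-(Complex.I * τ * Real.pi))) / 2) := by
    rw [Complex.ofReal_sin, Complex.sin]
    push_cast
    ring_nf
  have h2 := h.mul_left (-Complex.I)
  rw [← e] at h2
  rw [← Complex.hasSum_ofReal]
  have e2 : ∀ n : ℤ, -Complex.I * ((expCoeff (-1) τ (n - 1 / 2) : ℂ) * ((-1) ^ n * -Complex.I)) =
      ((-((-1) ^ n * expCoeff (-1) τ (n - 1 / 2)) : ℝ) : ℂ) := by
    intro n
    push_cast
    linear_combination (expCoeff (-1) τ (n - 1 / 2) : ℂ) * (-1) ^ n * Complex.I_mul_I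
  simpa only [e2] using h2

/-- The derivative is `cos πx - πx sin πx`, nonnegative since `sin πx ≤ cos πx` and `πx ≤ π/4 ≤ 1`
on this range. -/
theorem mul_cos_pi_mul_le {s t : ℝ} (h0 : 0 ≤ s) (hst : s ≤ t) (ht : t ≤ 1 / 4) :
    s * Real.cos (Real.pi * s) ≤ t * Real.cos (Real.pi * t) := by
  have hd : ∀ x : ℝ, HasDerivAt (fun x => x * Real.cos (Real.pi * x))
      (1 * Real.cos (Real.pi * x) + x * (-Real.sin (Real.pi * x) * (Real.pi * 1))) x := fun x =>
    (hasDerivAt_id x).mul (((hasDerivAt_id x).const_mul Real.pi).cos)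
  have hm : MonotoneOn (fun x => x * Real.cos (Real.pi * x)) (Set.Icc 0 (1 / 4)) := by
    refine monotoneOn_of_deriv_nonneg (convex_Icc _ _) (by fun_prop)
      (fun x _ => (hd x).differentiableAt.differentiableWithinAt) fun x hx => ?_
    rw [interior_Icc] at hx
    rw [(hd x).deriv]
    have hpi := Real.pi_pos
    have hx1 : Real.pi * x ≤ Real.pi / 4 := by nlinarith [hx.2]
    have hx0 : 0 ≤ Real.pi * x := mul_nonneg hpi.le hx.1.le
    have hs : Real.sin (Real.pi * x) ≤ Real.cos (Real.pi * x) := by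
      rw [← Real.cos_pi_div_two_sub]
      exact Real.cos_le_cos_of_nonneg_of_le_pi hx0 (by linarith) (by linarith)
    have hs0 : 0 ≤ Real.sin (Real.pi * x) :=
      Real.sin_nonneg_of_nonneg_of_le_pi hx0 (by linarith)
    have hlt : Real.pi * x ≤ 1 := by linarith [Real.pi_le_four]
    nlinarith
  exact hm ⟨h0, hst.trans ht⟩ ⟨h0.trans hst, ht⟩ hst

theorem sinc_le_sinc {s t : ℝ} (h0 : 0 ≤ s) (hst : s ≤ t) (ht : t ≤ Real.pi) :
    Real.sinc t ≤ Real.sinc s := by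
  rcases h0.eq_or_lt with rfl | hs
  · simpa using Real.sinc_le_one t
  have ht0 := hs.trans_le hst
  rw [Real.sinc_of_ne_zero ht0.ne', Real.sinc_of_ne_zero hs.ne', div_le_div_iff₀ ht0 hs]
  have hmem : t ∈ Set.Icc 0 Real.pi := ⟨ht0.le, ht⟩
  have hmem0 : (0 : ℝ) ∈ Set.Icc 0 Real.pi := ⟨le_rfl, Real.pi_pos.le⟩
  have hle : 0 ≤ 1 - s / t := by
    rw [sub_nonneg, div_le_one ht0]
    exact hst
  have h := strictConcaveOn_sin_Icc.concaveOn.2 hmem hmem0 (div_nonneg hs.le ht0.le) hle (by ring)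
  simp only [smul_eq_mul, Real.sin_zero, mul_zero, add_zero, div_mul_cancel₀ s ht0.ne'] at h
  rw [div_mul_eq_mul_div, div_le_iff₀ ht0] at h
  linarith

theorem div_pi_mul_sub_le {s t N N' q : ℝ} (h0 : 0 ≤ s) (hst : s ≤ t) (hq : t ^ 2 < q)
    (hN0 : 0 ≤ N) (hN : N ≤ N') :
    N / (Real.pi * (q - s ^ 2)) ≤ N' / (Real.pi * (q - t ^ 2)) := by
  have hs : s ^ 2 ≤ t ^ 2 := pow_le_pow_left₀ h0 hst 2
  refine div_le_div₀ (hN0.trans hN) hN (mul_pos Real.pi_pos (by linarith)) ?_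
  exact mul_le_mul_of_nonneg_left (by linarith) Real.pi_pos.le

/-- The expansion behind Kadec's `1/4`-theorem. -/
theorem exists_expansion_exp {τ₀ : ℝ} (h0 : 0 ≤ τ₀) (h1 : τ₀ ≤ 1 / 4) :
    ∃ (ν : ℤ ⊕ ℤ → ℝ) (a : ℝ → ℤ ⊕ ℤ → ℝ) (M : ℤ ⊕ ℤ → ℝ), ν (Sum.inl 0) = 0 ∧
      HasSum M (1 - Real.cos (Real.pi * τ₀) + Real.sin (Real.pi * τ₀)) ∧
      ∀ τ, |τ| ≤ τ₀ → (∀ j, |a τ j - if j = Sum.inl 0 then 1 else 0| ≤ M j) ∧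
        ∀ θ : ℝ, |θ| ≤ Real.pi → HasSum (fun j => (a τ j : ℂ) * Complex.exp (Complex.I * ν j * θ))
          (Complex.exp (Complex.I * τ * θ)) := by
  have hτ₀ : |τ₀| ≤ 1 / 4 := by rwa [abs_of_nonneg h0]
  -- The majorant consists of the absolute deviations at the extreme value `τ₀`: each is monotone in
  -- `|τ|`, and the alternating sums at `θ = π` evaluate their total.
  refine ⟨Sum.elim (fun n => n) (fun n => n - 1 / 2),
    fun τ => Sum.elim (fun n => expCoeff 1 τ n) (fun n => expCoeff (-1) τ (n - 1 / 2)),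
    Sum.elim (fun n => (if n = 0 then 1 else 0) - (-1) ^ n * expCoeff 1 τ₀ n)
      (fun n => -((-1) ^ n * expCoeff (-1) τ₀ (n - 1 / 2))), by simp, ?_, fun τ hτ => ⟨?_, ?_⟩⟩
  · exact HasSum.sum ((hasSum_ite_eq 0 1).sub (hasSum_alternating_expCoeff_one hτ₀))
      (hasSum_alternating_expCoeff_neg_one hτ₀)
  · have hτ4 := hτ.trans h1
    have habs := abs_nonneg τ
    have hpi := Real.pi_pos
    rintro (n | n)
    · rcases eq_or_ne n 0 with rfl | hn
      · have e : ∀ t : ℝ, expCoeff 1 t ((0 : ℤ) : ℝ) = Real.sinc (Real.pi * t) := by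
          intro t
          simp [expCoeff]
        have e2 : Real.sinc (Real.pi * τ) = Real.sinc (Real.pi * |τ|) := by
          rcases abs_choice τ with h | h <;> simp [h]
        have h2 := sinc_le_sinc (s := Real.pi * |τ|) (t := Real.pi * τ₀) (by positivity)
          (by gcongr) (by nlinarith)
        simp only [Sum.elim_inl, e, if_true, zpow_zero, one_mul, e2]
        rw [abs_sub_comm, abs_of_nonneg (sub_nonneg.2 (Real.sinc_le_one _))]
        linarith
      · have hn1 : (1 : ℝ) ≤ (n : ℝ) ^ 2 := by
          have : (1 : ℝ) ≤ |(n : ℝ)| := by exact_mod_cast Int.one_le_abs hn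
          nlinarith [sq_abs (n : ℝ)]
        have e : -((-1) ^ n * expCoeff 1 τ₀ n) = |expCoeff 1 τ₀ n| := by
          rw [abs_expCoeff_one_int hτ₀ hn, expCoeff_one_int (by linarith) hn, mul_neg, neg_neg,
            ← mul_assoc, ← mul_zpow, abs_of_nonneg h0]
          norm_num
        simp only [Sum.elim_inl, Sum.inl.injEq, hn, if_false, sub_zero, zero_sub, e]
        rw [abs_expCoeff_one_int hτ4 hn, abs_expCoeff_one_int hτ₀ hn, abs_of_nonneg h0]
        have hs : 0 ≤ Real.sin (Real.pi * |τ|) :=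
          Real.sin_nonneg_of_nonneg_of_le_pi (by positivity) (by nlinarith)
        refine div_pi_mul_sub_le habs hτ (by nlinarith) (by positivity)
          (mul_le_mul hτ ?_ hs h0)
        exact Real.sin_le_sin_of_le_of_le_pi_div_two (by nlinarith) (by nlinarith) (by gcongr)
    · have hn1 := quarter_le_int_sub_half_sq n
      have e : -((-1) ^ n * expCoeff (-1) τ₀ (n - 1 / 2)) = |expCoeff (-1) τ₀ (n - 1 / 2)| := by
        rw [abs_expCoeff_neg_one_half hτ₀, expCoeff_neg_one_half (by linarith), mul_neg, neg_neg,
          ← mul_assoc, ← mul_zpow, abs_of_nonneg h0]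
        norm_num
      simp only [Sum.elim_inr, reduceCtorEq, if_false, sub_zero, e]
      rw [abs_expCoeff_neg_one_half hτ4, abs_expCoeff_neg_one_half hτ₀, abs_of_nonneg h0]
      exact div_pi_mul_sub_le habs hτ (by nlinarith)
        (mul_nonneg habs (cos_pi_mul_nonneg habs hτ4)) (mul_cos_pi_mul_le habs hτ h1)
  · intro θ hθ
    have hτ4 := hτ.trans h1
    have e : (Complex.exp (Complex.I * τ * θ) + Complex.exp (-(Complex.I * τ * θ))) / 2 +
        (Complex.exp (Complex.I * τ * θ) - Complex.exp (-(Complex.I * τ * θ))) / 2 =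
        Complex.exp (Complex.I * τ * θ) := by ring
    rw [← e]
    exact HasSum.sum (hasSum_expCoeff_one hτ4 hθ) (hasSum_expCoeff_neg_one hτ4 hθ)

/-! ### Multiplication operators on `ℓ^p`. -/

section Multiplication

variable {p : ℝ≥0∞} [Fact (1 ≤ p)]

/-- Multiplication by a bounded sequence on `ℓ^p`. -/
noncomputable def lpMul (p : ℝ≥0∞) [Fact (1 ≤ p)] (m : ℤ → ℂ) (C : ℝ) (hC : ∀ n, ‖m n‖ ≤ C) :
    lp (fun _ : ℤ => ℂ) p →L[ℂ] lp (fun _ : ℤ => ℂ) p :=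
  LinearMap.mkContinuous
    { toFun := fun c => ⟨fun n => m n * c n, ((lp.memℓp c).const_mul (C : ℂ)).mono' fun n => by
        have hC0 : 0 ≤ C := (norm_nonneg _).trans (hC n)
        rw [norm_mul, norm_mul, Complex.norm_real, Real.norm_of_nonneg hC0]
        exact mul_le_mul_of_nonneg_right (hC n) (norm_nonneg _)⟩
      map_add' := fun c d => by
        ext n
        exact mul_add _ _ _
      map_smul' := fun a c => by
        ext n
        exact mul_left_comm _ _ _ } C fun c => by
    have hC0 : 0 ≤ C := (norm_nonneg _).trans (hC 0)
    have hp : p ≠ 0 := (zero_lt_one.trans_le Fact.out).ne'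
    calc _ ≤ ‖(C : ℂ) • c‖ := lp.norm_mono hp fun n => by
          simp only [LinearMap.coe_mk, AddHom.coe_mk, lp.coeFn_smul, Pi.smul_apply, smul_eq_mul]
          rw [norm_mul, norm_mul, Complex.norm_real, Real.norm_of_nonneg hC0]
          exact mul_le_mul_of_nonneg_right (hC n) (norm_nonneg _)
      _ = C * ‖c‖ := by rw [norm_smul, Complex.norm_real, Real.norm_of_nonneg hC0]

theorem lpMul_apply (m : ℤ → ℂ) (C : ℝ) (hC : ∀ n, ‖m n‖ ≤ C) (c : lp (fun _ : ℤ => ℂ) p)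
    (n : ℤ) : lpMul p m C hC c n = m n * c n := rfl

theorem norm_lpMul_le (m : ℤ → ℂ) (C : ℝ) (hC : ∀ n, ‖m n‖ ≤ C) : ‖lpMul p m C hC‖ ≤ C :=
  LinearMap.mkContinuous_norm_le _ ((norm_nonneg _).trans (hC 0)) _

theorem lpMul_single (m : ℤ → ℂ) (C : ℝ) (hC : ∀ n, ‖m n‖ ≤ C) (n : ℤ) :
    lpMul p m C hC (lp.single p n (1 : ℂ)) = m n • lp.single p n (1 : ℂ) := by
  ext k
  rw [lpMul_apply, lp.coeFn_smul, Pi.smul_apply, lp.single_apply, smul_eq_mul]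
  rcases eq_or_ne k n with rfl | h
  · rfl
  · simp [Pi.single_eq_of_ne h]

end Multiplication

/-! ### Stability of atomic decompositions and bases. -/

section Frames

variable {E : Type*} [NormedAddCommGroup E] [NormedSpace ℂ E] {p : ℝ≥0∞} [Fact (1 ≤ p)]
  {x w : ℤ → E} {S : lp (fun _ : ℤ => ℂ) p →L[ℂ] E}

theorem IsSynthesisOperator.apply_single (hS : IsSynthesisOperator p x S) (n : ℤ) :
    S (lp.single p n (1 : ℂ)) = x n := by
  refine (hS _).unique ?_
  have h := hasSum_single (f := fun k : ℤ => (lp.single p n (1 : ℂ) : lp (fun _ : ℤ => ℂ) p) k • x k)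
    (L := SummationFilter.conditional ℤ) n fun k hk => by simp [Pi.single_eq_of_ne hk]
  simpa using h

theorem isSynthesisOperator_of_apply_single (hp : p ≠ ∞)
    (hS : ∀ n, S (lp.single p n (1 : ℂ)) = x n) : IsSynthesisOperator p x S := by
  intro c
  have h := (lp.hasSum_single hp c).mapL S
  have e : ∀ n, S (lp.single p n (c n)) = c n • x n := by
    intro n
    rw [← hS, ← map_smul, ← lp.single_smul, smul_eq_mul, mul_one]
  simp only [e] at h
  exact h.mono_left (SummationFilter.conditional ℤ).le_atTop

namespace IsAtomicDecomposition

variable {A B : ℝ} {Y : ℤ → StrongDual ℂ E}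

/-- The analysis operator `v ↦ (⟨v, y_n⟩)_n`. -/
noncomputable def analysis (h : IsAtomicDecomposition p A B Y x) :
    E →L[ℂ] lp (fun _ : ℤ => ℂ) p :=
  LinearMap.mkContinuous
    { toFun := fun v => ⟨fun n => Y n v, h.memlp v⟩
      map_add' := fun u v => by
        ext n
        exact map_add _ _ _
      map_smul' := fun a v => by
        ext n
        exact map_smul _ _ _ } B h.upper_bound

theorem analysis_apply (h : IsAtomicDecomposition p A B Y x) (v : E) (n : ℤ) :
    h.analysis v n = Y n v := rfl

theorem synthesis_analysis (h : IsAtomicDecomposition p A B Y x)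
    (hS : IsSynthesisOperator p x S) (v : E) : S (h.analysis v) = v :=
  (hS _).unique (h.expansion v)

/-- With `U = S' ∘ analysis = 1 - R` and `‖R‖ ≤ q < 1`, the functionals `Y n ∘ U⁻¹` work because `v
= U (U⁻¹ v)`. The estimates `(1 - q)‖v‖ ≤ ‖U v‖ ≤ (1 + q)‖v‖` give the bounds. -/
theorem perturb [CompleteSpace E] (h : IsAtomicDecomposition p A B Y x) (hA : 0 < A) (hAB : A ≤ B)
    (hS : IsSynthesisOperator p x S) {S' : lp (fun _ : ℤ => ℂ) p →L[ℂ] E}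
    (hS' : IsSynthesisOperator p w S') {q : ℝ} (hSS : ‖S' - S‖ * B ≤ q) (hq : q < 1) :
    (∃ Z : ℤ → StrongDual ℂ E,
      IsAtomicDecomposition p (A * (1 + q)⁻¹) (B * (1 - q)⁻¹) Z w) ∧
    (IsTwoSidedBasis x → IsTwoSidedBasis w) := by
  have hB : 0 < B := hA.trans_le hAB
  have hq0 : 0 ≤ q := (mul_nonneg (norm_nonneg _) hB.le).trans hSS
  set R : E →L[ℂ] E := (S - S').comp h.analysis with hR
  have hRv : ∀ v, ‖R v‖ ≤ q * ‖v‖ := fun v => by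
    calc ‖R v‖ ≤ ‖S - S'‖ * ‖h.analysis v‖ := (S - S').le_opNorm _
      _ ≤ ‖S' - S‖ * (B * ‖v‖) := by
        rw [norm_sub_rev]
        exact mul_le_mul_of_nonneg_left (h.upper_bound v) (norm_nonneg _)
      _ ≤ q * ‖v‖ := by
        rw [← mul_assoc]
        exact mul_le_mul_of_nonneg_right hSS (norm_nonneg _)
  have hRn : ‖R‖ < 1 := (R.opNorm_le_bound hq0 hRv).trans_lt hq
  let U : E ≃L[ℂ] E := ContinuousLinearEquiv.ofUnit (Units.oneSub R hRn)
  have hUR : ∀ v, U v = v - R v := fun v => rfl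
  have hU : ∀ v, U v = S' (h.analysis v) := fun v => by
    rw [hUR, hR, ContinuousLinearMap.comp_apply, sub_apply, h.synthesis_analysis hS]
    abel
  have hU1 : ∀ v, (1 - q) * ‖v‖ ≤ ‖U v‖ := fun v => by
    have h1 := norm_sub_norm_le v (R v)
    have h2 := hRv v
    rw [hUR]
    linarith
  have hU2 : ∀ v, ‖U v‖ ≤ (1 + q) * ‖v‖ := fun v => by
    have h1 := norm_sub_le v (R v)
    have h2 := hRv v
    rw [hUR]
    linarith
  have hS1 : ∀ v, ‖U.symm v‖ ≤ (1 - q)⁻¹ * ‖v‖ := fun v => by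
    have h1 := hU1 (U.symm v)
    rw [U.apply_symm_apply] at h1
    rwa [inv_mul_eq_div, le_div_iff₀' (by linarith)]
  have hS2 : ∀ v, (1 + q)⁻¹ * ‖v‖ ≤ ‖U.symm v‖ := fun v => by
    have h1 := hU2 (U.symm v)
    rw [U.apply_symm_apply] at h1
    rwa [inv_mul_eq_div, div_le_iff₀' (by linarith)]
  refine ⟨⟨fun n => (Y n).comp (U.symm : E →L[ℂ] E), fun v => h.memlp (U.symm v), fun v => ?_,
    fun v => ?_, fun v => ?_⟩, ?_⟩
  · rw [mul_assoc]
    exact (mul_le_mul_of_nonneg_left (hS2 v) hA.le).trans (h.lower_bound (U.symm v))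
  · rw [mul_assoc]
    exact (h.upper_bound (U.symm v)).trans (mul_le_mul_of_nonneg_left (hS1 v) hB.le)
  · have h1 := hS' (h.analysis (U.symm v))
    rwa [← hU, U.apply_symm_apply] at h1
  · rintro ⟨b, rfl⟩
    have hbo : ∀ i j, b.coord i (b.basis j) = if i = j then 1 else 0 := fun i j => by
      rw [b.ortho]
      unfold Pi.single Function.update
      split_ifs <;> simp
    -- Uniqueness of basis coefficients identifies `Y` with the coordinate functionals. Hence `U`
    -- carries `b.basis n` to `w n`, and an isomorphism preserves bases.
    have hYb : ∀ n v, Y n v = b.coord n v := fun n v => by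
      have h1 := (h.expansion v).mapL (b.coord n)
      refine HasSum.unique ?_ h1
      have h2 := hasSum_single (f := fun k : ℤ => b.coord n (Y k v • b.basis k))
        (L := SummationFilter.conditional ℤ) n fun k hk => by
          rw [map_smul, hbo, if_neg hk.symm, smul_zero]
      simpa [hbo] using h2
    have hUb : ∀ n, U (b.basis n) = w n := fun n => by
      have h1 : h.analysis (b.basis n) = lp.single p n (1 : ℂ) := by
        ext k
        rw [h.analysis_apply, hYb, hbo, lp.single_apply, Pi.single_apply]
      rw [hU, h1, hS'.apply_single]
    refine ⟨⟨w, fun n => (b.coord n).comp (U.symm : E →L[ℂ] E), fun i j => ?_, fun v => ?_⟩, rfl⟩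
    · rw [← hUb j]
      simpa using b.ortho i j
    · have h1 := (b.expansion (U.symm v)).mapL (U : E →L[ℂ] E)
      simpa [hUb] using h1

theorem one_le_mul_norm [Nontrivial E] (h : IsAtomicDecomposition p A B Y x)
    (hS : IsSynthesisOperator p x S) : 1 ≤ B * ‖S‖ := by
  obtain ⟨v, hv⟩ := exists_ne (0 : E)
  have h1 : ‖v‖ ≤ ‖S‖ * (B * ‖v‖) := by
    conv_lhs => rw [← h.synthesis_analysis hS v]
    exact (S.le_opNorm _).trans (mul_le_mul_of_nonneg_left (h.upper_bound v) (norm_nonneg _))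
  have h2 : 0 < ‖v‖ := norm_pos_iff.2 hv
  nlinarith

end IsAtomicDecomposition

/-! ### Perturbing the orbit sequence. -/

namespace IsIsometricRep

variable {T : ℝ → E →L[ℂ] E}

/-- The synthesis operator of a perturbed orbit sequence, with Kadec's bound on the difference. -/
theorem exists_synthesis_sub_of_lt [CompleteSpace E] (hT : IsIsometricRep T) {γ γ' δ : ℝ}
    (hspec : beurlingSpectrum T Set.univ ⊆ Set.Icc (-γ) γ) (hγ : 0 < γ) (hγ' : γ < γ')
    (hδ : 0 ≤ δ) (hδγ : δ * γ' ≤ Real.pi / 4) {x : E} {g g' : ℤ → ℝ}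
    (hg : ∀ n, |g' n - g n| ≤ δ) (hS : IsSynthesisOperator p (fun n => T (g n) x) S) :
    ∃ D : lp (fun _ : ℤ => ℂ) p →L[ℂ] E,
      ‖D‖ ≤ ‖S‖ * (1 - Real.cos (δ * γ') + Real.sin (δ * γ')) ∧
      ∀ n, D (lp.single p n (1 : ℂ)) = T (g' n) x - T (g n) x := by
  have hpi := Real.pi_pos
  have hγ'0 : 0 < γ' := hγ.trans hγ'
  have hτ0 : 0 ≤ δ * γ' / Real.pi := by positivity
  have hτ1 : δ * γ' / Real.pi ≤ 1 / 4 := by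
    rw [div_le_iff₀ hpi]
    linarith
  obtain ⟨ν, a, M, hν, hM, ha⟩ := exists_expansion_exp hτ0 hτ1
  rw [mul_div_cancel₀ _ hpi.ne'] at hM
  -- The substitution `θ = πξ/γ'` maps `[-γ', γ']` onto `[-π, π]` and makes `exp (i(g' n - g n)ξ)`
  -- equal to `exp (iτ_nθ)`.
  set τ : ℤ → ℝ := fun n => (g' n - g n) * γ' / Real.pi with hτ
  have hτn : ∀ n, |τ n| ≤ δ * γ' / Real.pi := fun n => by
    rw [hτ, abs_div, abs_mul, abs_of_pos hpi, abs_of_pos hγ'0]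
    gcongr
    exact hg n
  set m : ℤ ⊕ ℤ → ℤ → ℂ := fun j n => ((a (τ n) j - if j = Sum.inl 0 then 1 else 0 : ℝ) : ℂ)
  have hm : ∀ j n, ‖m j n‖ ≤ M j := fun j n => by
    rw [Complex.norm_real]
    exact (ha (τ n) (hτn n)).1 j
  set μ : ℤ ⊕ ℤ → ℝ := fun j => ν j * Real.pi / γ' with hμ
  have hexp : ∀ n, HasSum (fun j => m j n • T (μ j) (T (g n) x)) (T (g' n) x - T (g n) x) := by
    intro n
    have hsum : Summable fun j => ‖((a (τ n) j : ℝ) : ℂ)‖ := by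
      have h1 : HasSum (fun j : ℤ ⊕ ℤ => if j = Sum.inl 0 then (1 : ℝ) else 0) 1 :=
        hasSum_ite_eq (Sum.inl 0) 1
      refine (hM.summable.add h1.summable).of_nonneg_of_le (fun j => norm_nonneg _) fun j => ?_
      rw [Complex.norm_real, Real.norm_eq_abs]
      have h2 := (ha (τ n) (hτn n)).1 j
      have h3 := abs_sub_abs_le_abs_sub (a (τ n) j) (if j = Sum.inl 0 then 1 else 0)
      have h4 : |(if j = Sum.inl 0 then (1 : ℝ) else 0)| = if j = Sum.inl 0 then (1 : ℝ) else 0 := by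
        split_ifs <;> simp
      linarith
    have h1 := hT.hasSum_smul_of_hasSum_exp hspec hγ hγ' hsum μ (g' n - g n) (fun ξ hξ => by
      have hθ : |ξ * Real.pi / γ'| ≤ Real.pi := by
        rw [abs_div, abs_mul, abs_of_pos hpi, abs_of_pos hγ'0, div_le_iff₀ hγ'0, mul_comm]
        gcongr
      have h2 := (ha (τ n) (hτn n)).2 _ hθ
      have e1 : ∀ y : ℝ, Complex.I * y * ((ξ * Real.pi / γ' : ℝ) : ℂ) =
          Complex.I * ((y * Real.pi / γ' : ℝ) : ℂ) * ξ := by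
        intro y
        push_cast
        ring
      have e2 : τ n * Real.pi / γ' = g' n - g n := by
        rw [hτ]
        field_simp
      simpa only [e1, e2] using h2) (T (g n) x)
    have h2 : HasSum (fun j : ℤ ⊕ ℤ => if j = Sum.inl 0 then T (g n) x else 0) (T (g n) x) :=
      hasSum_ite_eq (Sum.inl 0) _
    have h3 := h1.sub h2
    rw [← ContinuousLinearMap.comp_apply (T (g' n - g n)), ← hT.map_add, sub_add_cancel] at h3
    have e : ∀ j, m j n • T (μ j) (T (g n) x) = ((a (τ n) j : ℝ) : ℂ) • T (μ j) (T (g n) x) -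
        if j = Sum.inl 0 then T (g n) x else 0 := by
      intro j
      by_cases hj : j = Sum.inl 0
      · simp only [m, hj, if_true, hμ, hν, zero_mul, zero_div, hT.map_zero]
        simp [sub_smul]
      · simp [m, hj]
    simpa only [e] using h3
  -- For fixed `j` the shift `μ j` does not depend on `n`, so the isometry `T (μ j)` comes out of
  -- the synthesis series and only the factor `m j n` acts on coefficients.
  set D : ℤ ⊕ ℤ → lp (fun _ : ℤ => ℂ) p →L[ℂ] E := fun j =>
    (T (μ j)).comp (S.comp (lpMul p (m j) (M j) (hm j))) with hD
  have hDn : ∀ j, ‖D j‖ ≤ ‖S‖ * M j := fun j => by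
    refine ContinuousLinearMap.opNorm_le_bound _
      (mul_nonneg (norm_nonneg _) ((norm_nonneg _).trans (hm j 0))) fun c => ?_
    rw [hD, ContinuousLinearMap.comp_apply, hT.norm_map, mul_assoc]
    exact (S.le_opNorm _).trans (mul_le_mul_of_nonneg_left
      ((ContinuousLinearMap.le_opNorm _ _).trans
        (mul_le_mul_of_nonneg_right (norm_lpMul_le _ _ _) (norm_nonneg _))) (norm_nonneg _))
  have hMS := hM.mul_left ‖S‖
  have hDs : Summable D := Summable.of_norm_bounded hMS.summable hDn
  refine ⟨∑' j, D j, tsum_of_norm_bounded hMS hDn, fun n => ?_⟩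
  have h1 := hDs.hasSum.mapL (ContinuousLinearMap.apply ℂ E (lp.single p n (1 : ℂ)))
  have e : ∀ j, D j (lp.single p n (1 : ℂ)) = m j n • T (μ j) (T (g n) x) := fun j => by
    simp only [hD, ContinuousLinearMap.comp_apply, lpMul_single, map_smul, hS.apply_single]
  simp only [ContinuousLinearMap.apply_apply, e] at h1
  exact h1.unique (hexp n)

/-- The cutoff needs room beyond `γ`, so the sharp constant comes from letting `γ'` decrease to `γ`.
The difference operator does not vary with `γ'`, being fixed by its values on unit vectors as `p <
∞`. -/
theorem exists_synthesis_sub [CompleteSpace E] (hT : IsIsometricRep T) {γ δ : ℝ}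
    (hspec : beurlingSpectrum T Set.univ ⊆ Set.Icc (-γ) γ) (hγ : 0 < γ)
    (hδ : 0 ≤ δ) (hδγ : δ * γ < Real.pi / 4) {x : E} {g g' : ℤ → ℝ} (hp : p ≠ ∞)
    (hg : ∀ n, |g' n - g n| ≤ δ) (hS : IsSynthesisOperator p (fun n => T (g n) x) S) :
    ∃ S' : lp (fun _ : ℤ => ℂ) p →L[ℂ] E,
      ‖S' - S‖ ≤ ‖S‖ * (1 - Real.cos (δ * γ) + Real.sin (δ * γ)) ∧
      IsSynthesisOperator p (fun n => T (g' n) x) S' := by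
  have hev : ∀ᶠ γ' in 𝓝[>] γ, δ * γ' ≤ Real.pi / 4 ∧ γ < γ' := by
    refine Filter.Eventually.and ?_ self_mem_nhdsWithin
    have hc : Tendsto (fun γ' => δ * γ') (𝓝[>] γ) (𝓝 (δ * γ)) :=
      ((continuous_const_mul δ).tendsto γ).mono_left nhdsWithin_le_nhds
    exact (hc.eventually (gt_mem_nhds hδγ)).mono fun _ h => le_of_lt h
  obtain ⟨γ₁, h1, h2⟩ := hev.exists
  obtain ⟨D, -, hD⟩ := hT.exists_synthesis_sub_of_lt hspec hγ h2 hδ h1 hg hS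
  refine ⟨S + D, ?_, isSynthesisOperator_of_apply_single hp fun n => ?_⟩
  · rw [add_sub_cancel_left]
    have hc : Continuous fun γ' : ℝ =>
        ‖S‖ * (1 - Real.cos (δ * γ') + Real.sin (δ * γ')) := by fun_prop
    refine ge_of_tendsto ((hc.tendsto γ).mono_left (nhdsWithin_le_nhds (s := Set.Ioi γ))) ?_
    filter_upwards [hev] with γ' hγ'
    obtain ⟨D', hD'n, hD'⟩ := hT.exists_synthesis_sub_of_lt hspec hγ hγ'.2 hδ hγ'.1 hg hS
    have e : D = D' := lp.ext_continuousLinearMap hp fun n => by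
      ext
      simp [hD, hD']
    rwa [e]
  · rw [add_apply, hS.apply_single, hD, add_sub_cancel]

end IsIsometricRep

end Frames

/-! ### The arcsine condition and the conclusion. -/

/-- Since `√2 sin (π/4 - t) = cos t - sin t`, taking sines in the hypothesis gives `1 - 1/c < cos t
- sin t`. The condition `1 ≤ c` makes the arcsine nonnegative, hence `t < π/4`. -/
theorem kadec_bound_of_lt_arcsin {t c : ℝ} (ht : 0 ≤ t) (hc : c = 0 ∨ 1 ≤ c)
    (h : t < Real.pi / 4 - Real.arcsin (1 / Real.sqrt 2 * (1 - 1 / c))) :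
    t < Real.pi / 4 ∧ c * (1 - Real.cos t + Real.sin t) < 1 := by
  have hpi := Real.pi_pos
  have h2 : 0 < Real.sqrt 2 := by positivity
  have h22 : Real.sqrt 2 * Real.sqrt 2 = 2 := Real.mul_self_sqrt (by norm_num)
  rcases hc with rfl | hc
  · have e : Real.arcsin (1 / Real.sqrt 2 * (1 - 1 / 0)) = Real.pi / 4 := by
      refine Real.arcsin_eq_of_sin_eq ?_ ⟨by linarith, by linarith⟩
      rw [Real.sin_pi_div_four]
      field_simp
      nlinarith
    rw [e] at h
    linarith
  · have hc0 : 0 < c := one_pos.trans_le hc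
    have hc1 : 1 / c ≤ 1 := (div_le_one hc0).2 hc
    have hy : 0 ≤ Real.arcsin (1 / Real.sqrt 2 * (1 - 1 / c)) :=
      Real.arcsin_nonneg.2 (mul_nonneg (by positivity) (by linarith))
    have ht4 : t < Real.pi / 4 := by linarith
    refine ⟨ht4, ?_⟩
    have h3 : Real.arcsin (1 / Real.sqrt 2 * (1 - 1 / c)) < Real.pi / 4 - t := by linarith
    rw [Real.arcsin_lt_iff_lt_sin' ⟨by linarith, by linarith⟩, Real.sin_sub,
      Real.sin_pi_div_four, Real.cos_pi_div_four] at h3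
    have h4 : 1 - 1 / c < Real.cos t - Real.sin t := by
      have h5 := mul_lt_mul_of_pos_left h3 h2
      have e1 : Real.sqrt 2 * (1 / Real.sqrt 2 * (1 - 1 / c)) = 1 - 1 / c := by field_simp
      have e2 : Real.sqrt 2 * (Real.sqrt 2 / 2 * Real.cos t - Real.sqrt 2 / 2 * Real.sin t) =
          Real.cos t - Real.sin t := by
        linear_combination (Real.cos t - Real.sin t) / 2 * h22
      rwa [e1, e2] at h5
    have h6 := mul_lt_mul_of_pos_left h4 hc0
    have e : c * (1 - 1 / c) = c - 1 := by field_simp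
    rw [e] at h6
    linarith

theorem mainTheorem4 {E : Type*} [NormedAddCommGroup E] [NormedSpace ℂ E] [CompleteSpace E]
    (T : ℝ → E →L[ℂ] E) (hT : IsIsometricRep T)
    (γ : ℝ) (hγ : 0 < γ) (hspec : beurlingSpectrum T Set.univ ⊆ Set.Icc (-γ) γ)
    (p : ℝ≥0∞) [Fact (1 ≤ p)] (hp : p ≠ ∞)
    (x : E) (g g' : ℤ → ℝ) (Y : ℤ → StrongDual ℂ E)
    (A B : ℝ) (hA : 0 < A) (hAB : A ≤ B)
    (hYX : IsAtomicDecomposition p A B Y (fun n => T (g n) x))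
    (TX : lp (fun _ : ℤ => ℂ) p →L[ℂ] E)
    (hTX : IsSynthesisOperator p (fun n => T (g n) x) TX)
    (δ : ℝ) (hδ : IsLUB (Set.range fun n : ℤ => |g' n - g n|) δ)
    (hδlt : δ < Real.pi / (4 * γ) -
      1 / γ * Real.arcsin (1 / Real.sqrt 2 * (1 - 1 / (B * ‖TX‖)))) :
    (∃ Z : ℤ → StrongDual ℂ E,
      IsAtomicDecomposition p
        (A * (1 + B * ‖TX‖ * (1 - Real.cos (δ * γ) + Real.sin (δ * γ)))⁻¹)
        (B * (1 - B * ‖TX‖ * (1 - Real.cos (δ * γ) + Real.sin (δ * γ)))⁻¹)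
        Z (fun n => T (g' n) x)) ∧
    (IsTwoSidedBasis (fun n => T (g n) x) → IsTwoSidedBasis (fun n => T (g' n) x)) := by
  have hB : 0 < B := hA.trans_le hAB
  have hg : ∀ n, |g' n - g n| ≤ δ := fun n => hδ.1 ⟨n, rfl⟩
  have hδ0 : 0 ≤ δ := (abs_nonneg _).trans (hg 0)
  -- The value `0` arises only for the zero space; otherwise synthesis after analysis is the
  -- identity of a nonzero space.
  have hc : B * ‖TX‖ = 0 ∨ 1 ≤ B * ‖TX‖ := by
    rcases subsingleton_or_nontrivial E with hE | hE
    · left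
      rw [Subsingleton.elim TX 0, norm_zero, mul_zero]
    · exact Or.inr (hYX.one_le_mul_norm hTX)
  have ht : δ * γ < Real.pi / 4 - Real.arcsin (1 / Real.sqrt 2 * (1 - 1 / (B * ‖TX‖))) := by
    have h := mul_lt_mul_of_pos_right hδlt hγ
    have e : (Real.pi / (4 * γ) - 1 / γ * Real.arcsin (1 / Real.sqrt 2 * (1 - 1 / (B * ‖TX‖)))) * γ =
        Real.pi / 4 - Real.arcsin (1 / Real.sqrt 2 * (1 - 1 / (B * ‖TX‖))) := by
      generalize Real.arcsin _ = y
      field_simp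
    rwa [e] at h
  obtain ⟨h4, hq⟩ := kadec_bound_of_lt_arcsin (by positivity) hc ht
  obtain ⟨S', hS'n, hS'⟩ := hT.exists_synthesis_sub hspec hγ hδ0 h4 hp hg hTX
  refine hYX.perturb hA hAB hTX hS' ?_ hq
  have h := mul_le_mul_of_nonneg_right hS'n hB.le
  linarith
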